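/- Let $n\ge 1$ and $k\ge 0$ be integers. A partition $\lambda=(\lambda_1\ge\dots\ge\lambda_n\ge 0)$ with at most $n$ parts is called $(n,k)$-restricted if $\lambda_1-\lambda_n\le k$. Let $\Lambda_n=\mathbb{Q}[x_1,\dots,x_n]^{S_n}$, with its linear basis of Schur polynomials $s_\lambda$ ($\lambda$ with at most $n$ parts); the Littlewood–Richardson coefficients are defined by $s_\lambda s_\mu=\sum_\nu c_{\lambda\mu}^\nu s_\nu$. Let $\mathcal F^{(n,k)}$ be the quotient of $\Lambda_n$ by the ideal generated by all $s_\lambda$ with $\lambda_1-\lambda_n=k+1$ and by $s_{(1^n)}-1$. It has the linear basis $s_\lambda$, $\lambda$ with at most $n-1$ parts and $\lambda_1\le k$. For $(n,k)$-restricted $\lambda,\mu,\nu$ the fusion coefficient $N_{\lambda\mu}^{(k)\nu}$ is the coefficient of $s_{\bar\nu}$ in the expansion of $s_{\bar\lambda}s_{\bar\mu}$ in this basis of $\mathcal F^{(n,k)}$ if $|\nu|=|\lambda|+|\mu|$, and $0$ otherwise, where $\bar\lambda=(\lambda_1-\lambda_n,\dots,\lambda_{n-1}-\lambda_n)$. A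 path from $\lambda$ to $\nu$ is a chain of partitions $\lambda=\lambda^{(0)}\subset\lambda^{(1)}\subset\dots\subset\lambda^{(N)}=\nu$ in which each $\lambda^{(i)}$ arises from $\lambda^{(i-1)}$ by adding one box; the label of that step is the column index minus the row index of the added box. For $\mu$ with $\mu_1\le 2$ and conjugate partition $(\mu_1',\mu_2')$, and for $\sigma\in S_2$, put $\sigma.\mu'=\sigma(\mu'+\rho)-\rho$ with $\rho=(1,0)$. Let $\Omega_k$ be the set of pairs $(\sigma,P)$ such that $\sigma\in S_2$, the entries $(\alpha_1,\alpha_2)=\sigma.\mu'$ are nonnegative, and $P$ is a path from $\lambda$ to $\nu$ of length $\alpha_1+\alpha_2$ whose labels are strictly decreasing in the first $\alpha_1$ steps and in the last $\alpha_2$ steps and for which the partitions $\lambda^{(\alpha_1)}$ and $\lambda^{(\alpha_1+\alpha_2)}=\nu$ are $(n,k)$-restricted. Let $\lambda,\mu,\nu$ be $(n,k)$-restricted and let $\mu$ have at most two columns, i.e. $\mu_1\le 2$. Then: (a) $N_{\lambda\mu}^{(k)\nu}\le c_{\lambda\mu}^\nu$. (b) If for every $(\sigma,P)\in\Omega_k$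 all the partitions on the path $P$ are $(n,k)$-restricted, then $N_{\lambda\mu}^{(k)\nu}=c_{\lambda\mu}^\nu$. The equality $N_{\lambda\mu}^{(k)\nu}=c_{\lambda\mu}^\nu$ also holds whenever $\lambda_1-\lambda_n\le k-1$. -/

import Mathlib

noncomputable section

namespace Fusion

open MvPolynomial

/-! ### Partitions with at most `n` parts -/

/-- Partitions with at most `n` parts, written `l 0 ≥ l 1 ≥ ⋯ ≥ l (n-1) ≥ 0`. -/
abbrev Part (n : ℕ) : Type := {l : Fin n → ℕ // Antitone l}

/-- The number of boxes of a partition. -/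
def Part.size {n : ℕ} (l : Part n) : ℕ := ∑ i, l.1 i

/-- The number `λ₁ - λₙ` (a true subtraction, since `λ₁ ≥ λₙ`). -/
def Part.width {n : ℕ} [NeZero n] (l : Part n) : ℕ := l.1 0 - l.1 (Fin.rev 0)

/-- The length of column `j` (counted from `0`) of the diagram of `l`, that is, the part of index
`j` of the conjugate partition. -/
def Part.conj {n : ℕ} (l : Part n) (j : ℕ) : ℕ := (Finset.univ.filter fun i => j < l.1 i).card

/-- The partition `(1ⁿ)`. -/
def Part.ones (n : ℕ) : Part n := ⟨fun _ => 1, fun _ _ _ => le_rfl⟩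

/-! ### Schur polynomials in `n` variables -/

/-- The ring of symmetric polynomials in `n` variables with rational coefficients. -/
abbrev SymPoly (n : ℕ) : Type := symmetricSubalgebra (Fin n) ℚ

/-- The alternant `det (x_i ^ (a_j))`. -/
def alternant {n : ℕ} (a : Fin n → ℕ) : MvPolynomial (Fin n) ℚ :=
  (Matrix.of fun i j : Fin n => (X i : MvPolynomial (Fin n) ℚ) ^ a j).det

/-- The staircase `δ = (n-1, n-2, …, 0)`. -/
def delta (n : ℕ) : Fin n → ℕ := fun j => n - 1 - j

theorem X_sub_X_dvd_alternant {n : ℕ} (a : Fin n → ℕ) {i j : Fin n} (h : i ≠ j) :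
    (X j - X i : MvPolynomial (Fin n) ℚ) ∣ alternant a := by
  rw [← Ideal.mem_span_singleton, ← Ideal.Quotient.eq_zero_iff_mem, alternant, RingHom.map_det]
  refine Matrix.det_zero_of_row_eq h ?_
  have hx : Ideal.Quotient.mk (Ideal.span {(X j - X i : MvPolynomial (Fin n) ℚ)}) (X i)
      = Ideal.Quotient.mk _ (X j) := by
    rw [eq_comm, Ideal.Quotient.eq]
    exact Ideal.mem_span_singleton_self _
  funext c
  simp [hx]

theorem irreducible_X_sub_X {n : ℕ} {i j : Fin n} (h : i ≠ j) :
    Irreducible (X j - X i : MvPolynomial (Fin n) ℚ) := by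
  have hc : coeff (Finsupp.single j 1) (X j - X i : MvPolynomial (Fin n) ℚ) = 1 := by
    simp [coeff_X, Finsupp.single_left_inj, h]
  have hd : (X j - X i : MvPolynomial (Fin n) ℚ).totalDegree = 1 := by
    apply le_antisymm
    · exact (totalDegree_sub _ _).trans (by simp)
    · have := le_totalDegree (p := (X j - X i : MvPolynomial (Fin n) ℚ))
        (s := Finsupp.single j 1) (by rw [mem_support_iff, hc]; exact one_ne_zero)
      simpa using this
  refine irreducible_of_totalDegree_eq_one hd fun x hx => ?_
  have := hx (Finsupp.single j 1)
  rw [hc] at this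
  exact isUnit_of_dvd_one this

theorem isRelPrime_X_sub_X {n : ℕ} {i j k l : Fin n} (hij : i < j) (hkl : k < l)
    (h : (i, j) ≠ (k, l)) :
    IsRelPrime (X j - X i : MvPolynomial (Fin n) ℚ) (X l - X k) := by
  rw [(irreducible_X_sub_X hij.ne).isRelPrime_iff_not_dvd]
  rintro ⟨q, hq⟩
  have key : ∀ v : Fin n → ℚ, v i = v j → v k = v l := by
    intro v hv
    have := congrArg (eval v) hq
    simp only [map_sub, eval_X, map_mul, hv, sub_self, zero_mul] at this
    linarith
  by_cases hk : k = i ∨ k = j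
  · by_cases hl : l = i ∨ l = j
    · apply h
      rcases hk with rfl | rfl <;> rcases hl with rfl | rfl
      · exact absurd hkl (lt_irrefl _)
      · rfl
      · exact absurd hkl (not_lt.2 hij.le)
      · exact absurd hkl (lt_irrefl _)
    · push Not at hl
      have := key (Pi.single l 1) (by simp [hl.1.symm, hl.2.symm])
      simp [hkl.ne] at this
  · push Not at hk
    have := key (Pi.single k 1) (by simp [hk.1.symm, hk.2.symm])
    simp [hkl.ne'] at this

theorem prod_dvd_alternant {n : ℕ} (a : Fin n → ℕ) :
    (∏ i : Fin n, ∏ j ∈ Finset.Ioi i, (X j - X i : MvPolynomial (Fin n) ℚ)) ∣ alternant a := by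
  rw [Finset.prod_sigma']
  refine Finset.prod_dvd_of_isRelPrime ?_ ?_
  · rintro ⟨i, j⟩ hij ⟨k, l⟩ hkl hne
    simp only [Finset.coe_sigma, Set.mem_sigma_iff, Finset.mem_coe, Finset.mem_Ioi] at hij hkl
    refine isRelPrime_X_sub_X hij.2 hkl.2 fun h => hne ?_
    simp only [Prod.mk.injEq] at h
    rw [h.1, h.2]
  · rintro ⟨i, j⟩ hij
    simp only [Finset.mem_sigma, Finset.mem_Ioi] at hij
    exact X_sub_X_dvd_alternant a hij.2.ne

theorem alternant_delta (n : ℕ) : ∃ u : ℤˣ, alternant (delta n) =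
    ((u : ℤ) : MvPolynomial (Fin n) ℚ) *
      ∏ i : Fin n, ∏ j ∈ Finset.Ioi i, (X j - X i : MvPolynomial (Fin n) ℚ) := by
  refine ⟨Equiv.Perm.sign (Fin.revPerm : Equiv.Perm (Fin n)), ?_⟩
  rw [← Matrix.det_vandermonde, ← Matrix.det_permute', alternant]
  congr 1
  ext1 i j
  simp only [Matrix.of_apply, Matrix.submatrix_apply, Matrix.vandermonde_apply, id, delta,
    Fin.revPerm_apply, Fin.val_rev]
  congr 1
  omega

theorem alternant_delta_ne_zero (n : ℕ) : alternant (delta n) ≠ 0 := by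
  obtain ⟨u, hu⟩ := alternant_delta n
  rw [hu]
  refine mul_ne_zero ?_ (Finset.prod_ne_zero_iff.2 fun i _ => Finset.prod_ne_zero_iff.2
    fun j hj => (irreducible_X_sub_X (Finset.mem_Ioi.1 hj).ne).ne_zero)
  exact_mod_cast u.ne_zero

theorem alternant_delta_dvd {n : ℕ} (a : Fin n → ℕ) : alternant (delta n) ∣ alternant a := by
  obtain ⟨u, hu⟩ := alternant_delta n
  rw [hu]
  refine (IsUnit.mul_left_dvd ?_).2 (prod_dvd_alternant a)
  exact (u.isUnit.map (Int.castRingHom (MvPolynomial (Fin n) ℚ)))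

theorem rename_alternant {n : ℕ} (e : Equiv.Perm (Fin n)) (a : Fin n → ℕ) :
    rename e (alternant a) =
      ((Equiv.Perm.sign e : ℤ) : MvPolynomial (Fin n) ℚ) * alternant a := by
  rw [alternant, ← Matrix.det_permute, AlgHom.map_det]
  congr 1
  ext1 i j
  simp

/-- The Schur polynomial `s_λ = a_{λ+δ} / a_δ` in `n` variables, as a polynomial. -/
def schurPoly {n : ℕ} (l : Part n) : MvPolynomial (Fin n) ℚ :=
  (alternant_delta_dvd (l.1 + delta n)).choose

theorem alternant_delta_mul_schurPoly {n : ℕ} (l : Part n) :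
    alternant (delta n) * schurPoly l = alternant (l.1 + delta n) :=
  (alternant_delta_dvd (l.1 + delta n)).choose_spec.symm

theorem schurPoly_isSymmetric {n : ℕ} (l : Part n) : (schurPoly l).IsSymmetric := by
  intro e
  have h := congrArg (rename e) (alternant_delta_mul_schurPoly l)
  rw [map_mul, rename_alternant, rename_alternant, ← alternant_delta_mul_schurPoly, mul_assoc] at h
  have hu : ((Equiv.Perm.sign e : ℤ) : MvPolynomial (Fin n) ℚ) ≠ 0 := by
    exact_mod_cast (Equiv.Perm.sign e).ne_zero
  exact mul_left_cancel₀ (alternant_delta_ne_zero n) (mul_left_cancel₀ hu h)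

/-- The Schur polynomial `s_λ` as an element of the ring of symmetric polynomials. -/
def schur {n : ℕ} (l : Part n) : SymPoly n := ⟨schurPoly l, schurPoly_isSymmetric l⟩

/-! ### Structure constants -/

/-- The family `b` is a `ℚ`-linear basis of the algebra `A`. -/
def IsLinearBasis {ι A : Type} [CommRing A] [Algebra ℚ A] (b : ι → A) : Prop :=
  LinearIndependent ℚ b ∧ Submodule.span ℚ (Set.range b) = ⊤

open Classical in
/-- The structure constants of the algebra `A` with respect to the linear basis `b`:
the coefficient of `b l` in the expansion of `b i * b j`. -/
def structureConstant {ι A : Type} [CommRing A] [Algebra ℚ A] (b : ι → A) (i j l : ι) : ℚ :=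
  if h : IsLinearBasis b then (Module.Basis.mk h.1 h.2.ge).repr (b i * b j) l else 0

/-- The Littlewood–Richardson coefficient `c_{λμ}^ν`: the coefficient of `s_ν` in `s_λ s_μ`. -/
def lrCoeff {n : ℕ} (lam mu nu : Part n) : ℚ :=
  structureConstant (schur (n := n)) lam mu nu

/-! ### The fusion algebra -/

/-- The ideal generated by `s_λ` for `λ₁ - λₙ = k + 1`, and by `s_{(1ⁿ)} - 1`. -/
def fusionIdeal (n k : ℕ) [NeZero n] : Ideal (SymPoly n) :=
  Ideal.span ({f | ∃ l : Part n, l.width = k + 1 ∧ f = schur l} ∪ {schur (Part.ones n) - 1})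

/-- The fusion algebra of type `sl(n)` at level `k`. -/
abbrev FusionAlgebra (n k : ℕ) [NeZero n] : Type := SymPoly n ⧸ fusionIdeal n k

/-- The `(n,k)`-restricted partitions: at most `n` parts and `λ₁ - λₙ ≤ k`. -/
abbrev RestrictedPart (n k : ℕ) [NeZero n] : Type := {l : Part n // l.width ≤ k}

/-- The partitions with at most `n - 1` parts and `λ₁ ≤ k`. -/
abbrev ReducedPart (n k : ℕ) [NeZero n] : Type :=
  {l : Part n // l.1 (Fin.rev 0) = 0 ∧ l.1 0 ≤ k}

/-- The map `λ ↦ (λ₁ - λₙ, …, λₙ₋₁ - λₙ, 0)`. -/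
def RestrictedPart.reduce {n k : ℕ} [NeZero n] (l : RestrictedPart n k) : ReducedPart n k :=
  ⟨⟨fun i => l.1.1 i - l.1.1 (Fin.rev 0), fun _ _ h => Nat.sub_le_sub_right (l.1.2 h) _⟩,
    Nat.sub_self _, l.2⟩

/-- The class of `s_λ` in the fusion algebra, for `λ` with at most `n - 1` parts and `λ₁ ≤ k`. -/
def fusionSchur (n k : ℕ) [NeZero n] (l : ReducedPart n k) : FusionAlgebra n k :=
  Ideal.Quotient.mk (fusionIdeal n k) (schur l.1)

/-- The fusion coefficient `N_{λμ}^{(k)ν}` for `(n,k)`-restricted partitions. In the fusion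
algebra `s_ν` depends only on the reduced partition of `ν`, so `ν` is pinned down by
`|ν| = |λ| + |μ|` among the restricted partitions with the same reduction. -/
def fusionCoeff {n k : ℕ} [NeZero n] (lam mu nu : RestrictedPart n k) : ℚ :=
  if nu.1.size = lam.1.size + mu.1.size then
    structureConstant (fusionSchur n k) lam.reduce mu.reduce nu.reduce
  else 0

/-! ### Paths in Young's lattice -/

/-- The partition `b` arises from `a` by adding one box. -/
def AddsBox {n : ℕ} (a b : Part n) : Prop := ∃ i, b.1 = a.1 + Pi.single i 1

/-- A path in Young's lattice from `lam` to `nu`: a chain of partitions, each of which differs from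
the previous one by one box. (Since `nu` has at most `n` parts, so do all of them.) -/
structure YoungPath {n : ℕ} (lam nu : Part n) where
  length : ℕ
  vertex : Fin (length + 1) → Part n
  start_eq : vertex 0 = lam
  end_eq : vertex (Fin.last length) = nu
  step : ∀ t : Fin length, AddsBox (vertex t.castSucc) (vertex t.succ)

/-- The label (column minus row) of the box added in step `t`; exactly one row contributes to the
sum, and the column of the new box in row `i` is the new length of that row. -/
def YoungPath.label {n : ℕ} {lam nu : Part n} (P : YoungPath lam nu) (t : Fin P.length) : ℤ :=
  ∑ i : Fin n with (P.vertex t.castSucc).1 i < (P.vertex t.succ).1 i,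
    (((P.vertex t.succ).1 i : ℤ) - ((i : ℤ) + 1))

/-- `P` has ascents included in positions `α`: the entries of `α` are nonnegative, they add up to
the length of `P`, and in each of the successive blocks of steps of lengths `α 0, α 1, …` the labels
are decreasing. -/
def YoungPath.HasAscentsIn {n m : ℕ} {lam nu : Part n} (P : YoungPath lam nu) (α : Fin m → ℤ) :
    Prop :=
  (∀ i, 0 ≤ α i) ∧ ∑ i, α i = P.length ∧
    ∀ (i : Fin m) (s t : Fin P.length), s < t → ∑ j ∈ Finset.Iio i, α j ≤ (s : ℤ) →
      (t : ℤ) < ∑ j ∈ Finset.Iic i, α j → P.label t < P.label s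

/-- `σ . α = σ (α + ρ) - ρ` with `ρ = (m-1, …, 1, 0)`. -/
def dotAction {m : ℕ} (σ : Equiv.Perm (Fin m)) (α : Fin m → ℤ) : Fin m → ℤ :=
  fun i => (α (σ⁻¹ i) + (m - 1 - (σ⁻¹ i : Fin m) : ℤ)) - (m - 1 - i : ℤ)

/-- The set `Ω_k` of pairs `(σ, P)` with `σ ∈ S_m` and `P` a path from `lam` to `nu` with ascents
included in positions `σ . μ'` such that the partitions reached at the end of each block are
`(n,k)`-restricted. Here `m` is at least the number of columns of `mu`. -/
def Omega {n : ℕ} [NeZero n] (m k : ℕ) (lam mu nu : Part n) :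
    Set (Equiv.Perm (Fin m) × YoungPath lam nu) :=
  {p | p.2.HasAscentsIn (dotAction p.1 fun j => (mu.conj j : ℤ)) ∧
    ∀ (i : Fin m) (t : Fin (p.2.length + 1)),
      (t : ℤ) = ∑ j ∈ Finset.Iic i, dotAction p.1 (fun j => (mu.conj j : ℤ)) j →
        (p.2.vertex t).width ≤ k}

end Fusion

end

noncomputable section

namespace Fusion

open MvPolynomial

/-! ### Alternants -/

/-! Let `a ≥ b` be the column lengths of μ. The dual Jacobi–Trudi identity reads `s_μ = e_a e_b -
e_{a+1} e_{b-1}` (`schur_eq_esym`), so the Pieri rule makes `c_{λμ}^ν` the number of chains `λ ⊆ κ ⊆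
ν` of vertical strips of lengths `a, b` minus the number for `a+1, b-1` (`lrCoeff_eq`). A vertical
strip raises the width by at most one, so the unrestricted terms of a Pieri product of a restricted
λ have width `k + 1` and vanish in the fusion algebra (`fusionClass_mul_esym`). Hence `c - N` is the
same difference taken over the chains whose middle term κ is not restricted
(`lrCoeff_sub_fusionCoeff`).

For (a): if κ is not restricted, its strip over λ contains the first row and misses the last one.
Such chains correspond to sets of rows between two fixed sets `A` and `B`, initial in every block of
equal rows of λ. Counted by size they are the coefficients of a product of polynomials `X^l + ⋯ +
X^u`, a symmetric unimodal sequence. Its centre is `(a + b) / 2 ≤ a`, so the count does not grow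
from `a` to `a + 1` (`chainCount_succ_le`).

For (b): by (a)'s inequality, `N ≠ c` forces an unrestricted chain with lengths `a, b`. Its boxes
can be redistributed so that the first and the last row are filled within the same strip. The block
ends are then restricted, yet filling from top to bottom passes through width `k + 1`
(`exists_mem_Omega_of_chain`). If the width of λ is below `k`, no chain leaves at all.

That the fusion Schur classes form a basis is proved by reducing exponents modulo the translations
of an affine symmetric group (`weightCoeff_schur`). -/

theorem alternant_eq_sum {n : ℕ} (a : Fin n → ℕ) :
    alternant a = ∑ σ : Equiv.Perm (Fin n),
      ((Equiv.Perm.sign σ : ℤ) : MvPolynomial (Fin n) ℚ) * ∏ j, X (σ j) ^ a j := by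
  rw [alternant, Matrix.det_apply']
  simp

theorem perm_eq_one_of_strictAnti {n : ℕ} {α : Type*} [LinearOrder α] {a : Fin n → α}
    (ha : StrictAnti a) {σ : Equiv.Perm (Fin n)} (h : StrictAnti (a ∘ σ)) : σ = 1 := by
  have hσ : StrictMono σ := fun i j hij => ha.lt_iff_gt.1 (h hij)
  ext i
  have := congrArg (fun e : Fin n ≃o Fin n => e i)
    (Subsingleton.elim (hσ.orderIsoOfSurjective _ σ.surjective) (OrderIso.refl _))
  simpa using congrArg Fin.val this

theorem strictAnti_add_delta {n : ℕ} (l : Part n) : StrictAnti (l.1 + delta n) := by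
  intro i j hij
  have := l.2 hij.le
  simp only [Pi.add_apply, delta]
  have := j.2
  have : (i : ℕ) < j := hij
  omega

theorem prod_X_pow_perm {n : ℕ} (a : Fin n → ℕ) (σ : Equiv.Perm (Fin n)) :
    (∏ j, X (σ j) ^ a j : MvPolynomial (Fin n) ℚ) =
      monomial (Finsupp.equivFunOnFinite.symm (a ∘ σ.symm)) 1 := by
  rw [monomial_eq, Finsupp.prod_fintype _ _ (by simp), map_one, one_mul]
  refine Fintype.prod_equiv σ _ _ fun j => by simp

/-- Among the permuted exponent vectors `a ∘ σ⁻¹` only the one with `σ = 1` is strictly decreasing,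
so at most one term of the determinant contributes. -/
theorem coeff_alternant {n : ℕ} {a b : Fin n → ℕ} (ha : StrictAnti a) (hb : StrictAnti b) :
    coeff (Finsupp.equivFunOnFinite.symm b) (alternant a) = if a = b then 1 else 0 := by
  rw [alternant_eq_sum, coeff_sum]
  have key : ∀ σ : Equiv.Perm (Fin n), a ∘ σ.symm = b → σ = 1 := by
    intro σ h
    have := perm_eq_one_of_strictAnti ha (σ := σ.symm) (h ▸ hb)
    rw [← Equiv.symm_symm σ, this]
    rfl
  rw [Finset.sum_eq_single 1]
  · simp only [Equiv.Perm.sign_one, Units.val_one, Int.cast_one, one_mul, prod_X_pow_perm,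
      coeff_monomial, EmbeddingLike.apply_eq_iff_eq]
    rfl
  · intro σ _ hσ
    rw [← map_intCast (C : ℚ →+* MvPolynomial (Fin n) ℚ), coeff_C_mul, prod_X_pow_perm,
      coeff_monomial, if_neg, mul_zero]
    intro h
    exact hσ (key σ (by simpa using h))
  · simp

/-! ### Schur polynomials -/

/-- The coefficient of `s_ν` in the expansion of a symmetric polynomial. -/
def schurCoeff {n : ℕ} (nu : Part n) : SymPoly n →ₗ[ℚ] ℚ :=
  lcoeff ℚ (Finsupp.equivFunOnFinite.symm (nu.1 + delta n)) ∘ₗ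
    LinearMap.mulLeft ℚ (alternant (delta n)) ∘ₗ (symmetricSubalgebra (Fin n) ℚ).val.toLinearMap

-- These functionals are dual to the Schur polynomials. They give linear independence and later
-- extract structure constants.
open Classical in
theorem schurCoeff_schur {n : ℕ} (nu l : Part n) :
    schurCoeff nu (schur l) = if l = nu then 1 else 0 := by
  have : schurCoeff nu (schur l) = coeff (Finsupp.equivFunOnFinite.symm (nu.1 + delta n))
      (alternant (delta n) * schurPoly l) := rfl
  rw [this, alternant_delta_mul_schurPoly,
    coeff_alternant (strictAnti_add_delta l) (strictAnti_add_delta nu)]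
  simp [Subtype.ext_iff]

theorem linearIndependent_of_dual {ι M : Type*} [AddCommGroup M] [Module ℚ M] (v : ι → M)
    (φ : ι → M →ₗ[ℚ] ℚ) (h1 : ∀ i, φ i (v i) = 1) (h0 : ∀ i j, i ≠ j → φ i (v j) = 0) :
    LinearIndependent ℚ v := by
  rw [linearIndependent_iff']
  intro s g hg i hi
  have := congrArg (φ i) hg
  rw [map_sum, map_zero, Finset.sum_eq_single i] at this
  · simpa [h1] using this
  · intro j _ hj
    simp [h0 i j hj.symm]
  · exact fun h => absurd hi h

theorem linearIndependent_schur (n : ℕ) : LinearIndependent ℚ (schur (n := n)) :=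
  linearIndependent_of_dual _ schurCoeff (fun i => by simp [schurCoeff_schur])
    fun i j h => by simp [schurCoeff_schur, h.symm]

/-! ### The Pieri rule -/

/-- The elementary symmetric polynomial `e_j`, with `e_j = 0` for negative `j`. -/
def esym (n : ℕ) (j : ℤ) : SymPoly n :=
  if 0 ≤ j then ⟨esymm (Fin n) ℚ j.toNat, esymm_isSymmetric _ _ _⟩ else 0

theorem esym_natCast (n j : ℕ) :
    esym n j = ⟨esymm (Fin n) ℚ j, esymm_isSymmetric _ _ _⟩ := by
  simp [esym]

theorem esym_of_neg {n : ℕ} {j : ℤ} (h : j < 0) : esym n j = 0 := by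
  simp [esym, not_le.2 h]

/-- `κ / λ` is a vertical strip. -/
def VerticalStrip {n : ℕ} (l m : Part n) : Prop := ∀ i, l.1 i ≤ m.1 i ∧ m.1 i ≤ l.1 i + 1

theorem finite_verticalStrip {n : ℕ} (l : Part n) (j : ℤ) :
    {m : Part n | VerticalStrip l m ∧ (m.size : ℤ) = l.size + j}.Finite := by
  refine Set.Finite.of_finite_image (f := Subtype.val) ?_ Subtype.val_injective.injOn
  refine (Set.finite_Icc l.1 (l.1 + 1)).subset ?_
  rintro _ ⟨m, ⟨hm, _⟩, rfl⟩
  exact ⟨fun i => (hm i).1, fun i => (hm i).2⟩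

/-- The partitions that arise from `l` by adding a vertical strip of `j` boxes. -/
def strips {n : ℕ} (l : Part n) (j : ℤ) : Finset (Part n) := (finite_verticalStrip l j).toFinset

theorem mem_strips {n : ℕ} {l m : Part n} {j : ℤ} :
    m ∈ strips l j ↔ VerticalStrip l m ∧ (m.size : ℤ) = l.size + j := by
  simp [strips]

/-- The indicator function of a set of rows. -/
def ind {n : ℕ} (S : Finset (Fin n)) : Fin n → ℕ := fun i => if i ∈ S then 1 else 0

theorem ind_le_one {n : ℕ} (S : Finset (Fin n)) (i : Fin n) : ind S i ≤ 1 := by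
  unfold ind
  split_ifs <;> simp

theorem sum_ind {n : ℕ} (S : Finset (Fin n)) : ∑ i, ind S i = S.card := by
  simp [ind]

/-- Since `e_r` is symmetric, in the σ-term of the determinant it can be replaced by its renaming
along σ. Each monomial of it then raises the exponents indexed by a set `S`. -/
theorem alternant_mul_esymm {n : ℕ} (a : Fin n → ℕ) (r : ℕ) :
    alternant a * esymm (Fin n) ℚ r =
      ∑ S ∈ Finset.powersetCard r Finset.univ, alternant (a + ind S) := by
  simp only [alternant_eq_sum]
  rw [Finset.sum_comm, Finset.sum_mul]
  refine Finset.sum_congr rfl fun σ _ => ?_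
  rw [← rename_esymm (Fin n) ℚ r σ, esymm, map_sum, Finset.mul_sum]
  refine Finset.sum_congr rfl fun S _ => ?_
  rw [mul_assoc]
  congr 1
  simp only [Pi.add_apply, pow_add, Finset.prod_mul_distrib, map_prod, rename_X]
  congr 1
  simp [ind, pow_ite, Finset.prod_ite_mem]

/-- Monotonicity can fail only at equal adjacent rows with the lower one in `S` and the upper one
not. The drop of one in δ then makes two exponents equal, hence two columns of the determinant. -/
theorem antitone_or_alternant_eq_zero {n : ℕ} (l : Part n) (S : Finset (Fin n)) :
    Antitone (l.1 + ind S) ∨ alternant (l.1 + delta n + ind S) = 0 := by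
  rw [or_iff_not_imp_left]
  intro h
  rcases n with _ | n
  · exact absurd (fun i => i.elim0) h
  rw [Fin.antitone_iff_succ_le] at h
  push Not at h
  obtain ⟨i, hi⟩ := h
  refine Matrix.det_zero_of_column_eq (i := i.castSucc) (j := i.succ) i.castSucc_lt_succ.ne ?_
  intro j
  have h1 := l.2 i.castSucc_lt_succ.le
  have h2 := ind_le_one S i.succ
  have h3 := i.2
  simp only [Pi.add_apply] at hi
  simp only [Matrix.of_apply, Pi.add_apply, delta, Fin.val_castSucc, Fin.val_succ]
  congr 1
  omega

theorem schur_mul_esym {n : ℕ} (l : Part n) (j : ℤ) :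
    schur l * esym n j = ∑ m ∈ strips l j, schur m := by
  classical
  by_cases hj : 0 ≤ j
  swap
  · rw [esym_of_neg (not_le.1 hj), mul_zero, Finset.sum_eq_zero]
    intro m hm
    rw [mem_strips] at hm
    have : l.size ≤ m.size := Finset.sum_le_sum fun i _ => (hm.1 i).1
    omega
  lift j to ℕ using hj
  ext1
  rw [esym_natCast]
  apply mul_left_cancel₀ (alternant_delta_ne_zero n)
  have e1 : (schur l * (⟨esymm (Fin n) ℚ j, esymm_isSymmetric _ _ _⟩ : SymPoly n) :
      SymPoly n).1 = schurPoly l * esymm (Fin n) ℚ j := rfl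
  have e2 : (∑ m ∈ strips l j, schur m : SymPoly n).1 = ∑ m ∈ strips l j, schurPoly m :=
    map_sum (symmetricSubalgebra (Fin n) ℚ).val _ _
  rw [e1, e2, ← mul_assoc, alternant_delta_mul_schurPoly, alternant_mul_esymm, Finset.mul_sum]
  simp only [alternant_delta_mul_schurPoly]
  symm
  -- Sets of rows that do not yield a partition have zero alternant, so only nonzero terms need to
  -- be matched.
  refine Finset.sum_bij_ne_zero (fun m _ _ => Finset.univ.filter fun i => l.1 i < m.1 i)
    ?_ ?_ ?_ ?_
  · intro m hm _
    rw [mem_strips] at hm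
    rw [Finset.mem_powersetCard]
    refine ⟨Finset.subset_univ _, ?_⟩
    have h : m.size = l.size + ∑ i, ind (Finset.univ.filter fun i => l.1 i < m.1 i) i := by
      simp only [Part.size]
      rw [← Finset.sum_add_distrib]
      refine Finset.sum_congr rfl fun i _ => ?_
      have := hm.1 i
      simp only [ind, Finset.mem_filter, Finset.mem_univ, true_and]
      split_ifs <;> omega
    rw [sum_ind] at h
    omega
  · intro m hm _ m' hm' _ h
    rw [mem_strips] at hm hm'
    ext i
    have := hm.1 i
    have := hm'.1 i
    have h := congrArg (i ∈ ·) h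
    simp only [Finset.mem_filter, Finset.mem_univ, true_and, eq_iff_iff] at h
    omega
  · intro S hS h0
    have ha := (antitone_or_alternant_eq_zero l S).resolve_right h0
    have hS' := (Finset.mem_powersetCard.1 hS).2
    refine ⟨⟨l.1 + ind S, ha⟩, ?_, ?_, ?_⟩
    · rw [mem_strips]
      refine ⟨fun i => ⟨by simp, by simpa using ind_le_one S i⟩, ?_⟩
      simp only [Part.size, Pi.add_apply, Finset.sum_add_distrib, sum_ind, hS']
      push_cast
      rfl
    · convert h0 using 2
      exact add_right_comm _ _ _
    · ext i
      by_cases hi : i ∈ S <;> simp [ind, hi]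
  · intro m hm _
    rw [mem_strips] at hm
    congr 1
    funext i
    have := hm.1 i
    simp only [Pi.add_apply, ind, Finset.mem_filter, Finset.mem_univ, true_and]
    split_ifs <;> omega

/-! ### Linear bases -/

/-- The elements whose multiplication preserves `V` form a subalgebra `B`. It contains the classes
of the `e_j`, which generate everything; applying `B` to `1 ∈ V` gives the claim. It serves `Λ_n`
(with `I = ⊥`) and the fusion algebra alike. -/
theorem span_eq_top_of_esym_mul_mem {n : ℕ} (I : Ideal (SymPoly n))
    (V : Submodule ℚ (SymPoly n ⧸ I)) (h1 : 1 ∈ V)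
    (hV : ∀ j : ℕ, ∀ v ∈ V, v * Ideal.Quotient.mk I (esym n j) ∈ V) : V = ⊤ := by
  let B : Subalgebra ℚ (SymPoly n ⧸ I) :=
    { carrier := {f | ∀ v ∈ V, v * f ∈ V}
      mul_mem' := fun {f g} hf hg v hv => by
        rw [← mul_assoc]
        exact hg _ (hf v hv)
      add_mem' := fun {f g} hf hg v hv => by
        rw [mul_add]
        exact V.add_mem (hf v hv) (hg v hv)
      algebraMap_mem' := fun r v hv => by
        have : v * algebraMap ℚ (SymPoly n ⧸ I) r = r • v :=
          ((Algebra.smul_def r v).trans (Algebra.commutes r v)).symm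
        exact this ▸ V.smul_mem r hv }
  rw [eq_top_iff]
  rintro x -
  obtain ⟨y, rfl⟩ := Ideal.Quotient.mk_surjective x
  obtain ⟨p, rfl⟩ := esymmAlgHom_surjective (σ := Fin n) (R := ℚ) (n := n) (by simp) y
  have key : ∀ p : MvPolynomial (Fin n) ℚ,
      Ideal.Quotient.mkₐ ℚ I (esymmAlgHom (Fin n) ℚ n p) ∈ B := by
    intro p
    have hp : p ∈ Algebra.adjoin ℚ (Set.range (X : Fin n → MvPolynomial (Fin n) ℚ)) := by
      rw [adjoin_range_X]
      trivial
    have hle : Algebra.adjoin ℚ (Set.range (X : Fin n → MvPolynomial (Fin n) ℚ)) ≤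
        B.comap ((Ideal.Quotient.mkₐ ℚ I).comp (esymmAlgHom (Fin n) ℚ n)) := by
      rw [Algebra.adjoin_le_iff]
      rintro _ ⟨i, rfl⟩
      intro v hv
      have := hV (i + 1) v hv
      rw [esym_natCast] at this
      simpa [esymmAlgHom] using this
    exact hle hp
  simpa using key p 1 h1

/-- The empty partition. -/
def Part.zero (n : ℕ) : Part n := ⟨fun _ => 0, fun _ _ _ => le_rfl⟩

theorem schur_zero (n : ℕ) : schur (Part.zero n) = 1 := by
  ext1
  apply mul_left_cancel₀ (alternant_delta_ne_zero n)
  have := alternant_delta_mul_schurPoly (Part.zero n)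
  rw [show (Part.zero n).1 + delta n = delta n from zero_add _] at this
  simpa [schur] using this

theorem isLinearBasis_schur (n : ℕ) : IsLinearBasis (schur (n := n)) := by
  refine ⟨linearIndependent_schur n, ?_⟩
  set V := Submodule.span ℚ (Set.range (schur (n := n))) with hVdef
  have h := span_eq_top_of_esym_mul_mem (⊥ : Ideal (SymPoly n))
    (V.map (Ideal.Quotient.mkₐ ℚ (⊥ : Ideal (SymPoly n))).toLinearMap) ?_ ?_
  · rw [eq_top_iff]
    rintro x -
    have hx : Ideal.Quotient.mk (⊥ : Ideal (SymPoly n)) x ∈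
        V.map (Ideal.Quotient.mkₐ ℚ (⊥ : Ideal (SymPoly n))).toLinearMap := by
      rw [h]
      trivial
    obtain ⟨y, hy, hyx⟩ := hx
    have : y - x ∈ (⊥ : Ideal (SymPoly n)) := Ideal.Quotient.eq.1 hyx
    rw [Ideal.mem_bot, sub_eq_zero] at this
    exact this ▸ hy
  · exact ⟨1, Submodule.subset_span ⟨_, schur_zero n⟩, rfl⟩
  · rintro j _ ⟨v, hv, rfl⟩
    refine ⟨v * esym n j, ?_, by simp⟩
    have : V ≤ V.comap (LinearMap.mulRight ℚ (esym n (j : ℤ))) := by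
      rw [hVdef, Submodule.span_le]
      rintro _ ⟨l, rfl⟩
      simp only [Submodule.comap_coe, Set.mem_preimage, LinearMap.mulRight_apply, SetLike.mem_coe,
        schur_mul_esym]
      exact Submodule.sum_mem _ fun m _ => Submodule.subset_span ⟨m, rfl⟩
    exact this hv

theorem structureConstant_eq {ι A : Type} [CommRing A] [Algebra ℚ A] {b : ι → A}
    (hb : IsLinearBasis b) (φ : A →ₗ[ℚ] ℚ) (i j l : ι) (h1 : φ (b l) = 1)
    (h0 : ∀ m, m ≠ l → φ (b m) = 0) : structureConstant b i j l = φ (b i * b j) := by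
  classical
  rw [structureConstant, dif_pos hb]
  set B := Module.Basis.mk hb.1 hb.2.ge
  have hBm : ∀ m, B m = b m := fun m => Module.Basis.mk_apply _ _ m
  have : (Finsupp.lapply l ∘ₗ B.repr.toLinearMap : A →ₗ[ℚ] ℚ) = φ := by
    refine B.ext fun m => ?_
    change B.repr (B m) l = φ (B m)
    rw [Module.Basis.repr_self, hBm, Finsupp.single_apply]
    split_ifs with hm
    · rw [hm, h1]
    · rw [h0 m hm]
  rw [← this]
  rfl

/-! ### Two-column partitions -/

theorem lt_card_filter_iff {n : ℕ} (p : Fin n → Prop) [DecidablePred p]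
    (hp : ∀ i j, i ≤ j → p j → p i) (i : Fin n) :
    (i : ℕ) < (Finset.univ.filter p).card ↔ p i := by
  constructor
  · intro h
    by_contra hi
    have : Finset.univ.filter p ⊆ Finset.Iio i := by
      intro j hj
      rw [Finset.mem_filter] at hj
      rw [Finset.mem_Iio]
      by_contra hij
      exact hi (hp i j (not_lt.1 hij) hj.2)
    have := Finset.card_le_card this
    rw [Fin.card_Iio] at this
    omega
  · intro h
    have : Finset.Iic i ⊆ Finset.univ.filter p := by
      intro j hj
      rw [Finset.mem_Iic] at hj
      simpa using hp j i hj h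
    have := Finset.card_le_card this
    rw [Fin.card_Iic] at this
    omega

theorem Part.lt_conj_iff {n : ℕ} (m : Part n) (v : ℕ) (i : Fin n) :
    (i : ℕ) < m.conj v ↔ v < m.1 i :=
  lt_card_filter_iff _ (fun _ _ h hj => hj.trans_le (m.2 h)) i

theorem Part.conj_le {n : ℕ} (m : Part n) (v : ℕ) : m.conj v ≤ n :=
  (Finset.card_filter_le _ _).trans (by simp)

theorem Part.conj_antitone {n : ℕ} (m : Part n) : Antitone m.conj := fun _ _ h =>
  Finset.card_le_card fun _ hi => by
    simp only [Finset.mem_filter, Finset.mem_univ, true_and] at hi ⊢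
    omega

theorem Part.size_eq_conj_add_conj {n : ℕ} {m : Part n} (hm : ∀ i, m.1 i ≤ 2) :
    m.size = m.conj 0 + m.conj 1 := by
  simp only [Part.size, Part.conj, Finset.card_filter, ← Finset.sum_add_distrib]
  refine Finset.sum_congr rfl fun i _ => ?_
  have := hm i
  split_ifs <;> omega

theorem Part.ext_of_conj {n : ℕ} {m m' : Part n} (hm : ∀ i, m.1 i ≤ 2) (hm' : ∀ i, m'.1 i ≤ 2)
    (h0 : m.conj 0 = m'.conj 0) (h1 : m.conj 1 = m'.conj 1) : m = m' := by
  ext i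
  have := m.lt_conj_iff 0 i
  have := m'.lt_conj_iff 0 i
  have := m.lt_conj_iff 1 i
  have := m'.lt_conj_iff 1 i
  have := hm i
  have := hm' i
  rw [h0] at *
  rw [h1] at *
  omega

/-- The partition `(1ʲ)`. -/
def Part.col (n j : ℕ) : Part n :=
  ⟨fun i => if (i : ℕ) < j then 1 else 0, fun i i' h => by
    have : (i : ℕ) ≤ i' := h
    dsimp only
    split_ifs <;> omega⟩

theorem Part.conj_zero_col {n j : ℕ} (hj : j ≤ n) : (Part.col n j).conj 0 = j := by
  have h := Fin.card_filter_val_lt (n := n) (m := j)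
  rw [min_eq_right hj] at h
  refine Eq.trans (congrArg Finset.card (Finset.filter_congr fun i _ => ?_)) h
  by_cases hi : (i : ℕ) < j <;> simp [Part.col, hi]

theorem Part.size_col {n j : ℕ} (hj : j ≤ n) : (Part.col n j).size = j := by
  rw [Part.size_eq_conj_add_conj, Part.conj_zero_col hj]
  · rw [Nat.add_eq_left, Part.conj, Finset.card_eq_zero, Finset.filter_eq_empty_iff]
    intro i _
    by_cases hi : (i : ℕ) < j <;> simp [Part.col, hi]
  · intro i
    simp only [Part.col]
    split_ifs <;> simp

theorem Part.size_zero (n : ℕ) : (Part.zero n).size = 0 := by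
  simp [Part.size, Part.zero]

theorem strips_zero {n j : ℕ} (hj : j ≤ n) : strips (Part.zero n) j = {Part.col n j} := by
  ext m
  rw [mem_strips, Finset.mem_singleton, Part.size_zero]
  constructor
  · rintro ⟨h, hs⟩
    have hm : ∀ i, m.1 i ≤ 1 := fun i => (h i).2
    have h2 := Part.size_eq_conj_add_conj fun i => (hm i).trans one_le_two
    have h3 : m.conj 1 = 0 := by
      simpa [Part.conj, Finset.card_eq_zero, Finset.filter_eq_empty_iff] using hm
    ext i
    have h4 := m.lt_conj_iff 0 i
    have := hm i
    simp only [Part.col]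
    split_ifs <;> omega
  · rintro rfl
    refine ⟨fun i => ?_, by rw [Part.size_col hj]; simp⟩
    simp only [Part.zero, Part.col]
    split_ifs <;> simp

theorem esym_eq_schur_col {n j : ℕ} (hj : j ≤ n) : esym n j = schur (Part.col n j) := by
  have := schur_mul_esym (Part.zero n) j
  rwa [schur_zero, one_mul, strips_zero hj, Finset.sum_singleton] at this

theorem esym_of_lt {n : ℕ} {j : ℕ} (hj : n < j) : esym n j = 0 := by
  have := schur_mul_esym (Part.zero n) j
  rw [schur_zero, one_mul] at this
  rw [this, Finset.sum_eq_zero]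
  intro m hm
  rw [mem_strips, Part.size_zero] at hm
  have : m.size ≤ ∑ i : Fin n, 1 := Finset.sum_le_sum fun i _ => (hm.1 i).2
  simp only [Finset.sum_const, Finset.card_univ, Fintype.card_fin, smul_eq_mul, mul_one] at this
  omega

/-- The second column of such an `m` has length at most `b`, and `hb` keeps it inside the first `a`
rows, so no row gains two boxes. -/
theorem mem_strips_col {n a : ℕ} {b : ℤ} (ha : a ≤ n) (hb : b ≤ a) (m : Part n) :
    m ∈ strips (Part.col n a) b ↔ (∀ i, m.1 i ≤ 2) ∧ (m.size : ℤ) = a + b ∧ a ≤ m.conj 0 := by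
  rw [mem_strips, Part.size_col ha]
  constructor
  · rintro ⟨h, hs⟩
    refine ⟨fun i => (h i).2.trans ?_, hs, ?_⟩
    · simp only [Part.col]
      split_ifs <;> simp
    · rcases a with _ | a
      · simp
      · have h1 := (h ⟨a, ha⟩).1
        have h2 := m.lt_conj_iff 0 ⟨a, ha⟩
        simp only [Part.col, Nat.lt_succ_self, if_true] at h1
        simp only at h2
        omega
  · rintro ⟨h, hs, hc⟩
    refine ⟨fun i => ?_, hs⟩
    have h0 := m.lt_conj_iff 0 i
    have h1 := m.lt_conj_iff 1 i
    have h2 := Part.size_eq_conj_add_conj h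
    have h3 := m.conj_antitone zero_le_one
    have := h i
    simp only [Part.col]
    split_ifs <;> omega

/-- The dual Jacobi–Trudi identity for two columns. -/
theorem schur_eq_esym {n : ℕ} {mu : Part n} (hmu : ∀ i, mu.1 i ≤ 2) :
    schur mu = esym n (mu.conj 0) * esym n (mu.conj 1) -
      esym n (mu.conj 0 + 1) * esym n (mu.conj 1 - 1) := by
  classical
  have h1 := mu.conj_antitone zero_le_one
  have h2 := Part.size_eq_conj_add_conj hmu
  have h3 := mu.conj_le 0
  -- Both products expand into two-column partitions of size `|μ|`: the first into those whose first
  -- column has at least `μ'₁` boxes, the second into those with at least `μ'₁ + 1`. They differ by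
  -- μ alone. If `μ'₁ = n`, the second product is zero.
  rw [eq_sub_iff_add_eq, esym_eq_schur_col h3, schur_mul_esym]
  by_cases h : mu.conj 0 + 1 ≤ n
  · have e : ((mu.conj 0 : ℤ) + 1) = ((mu.conj 0 + 1 : ℕ) : ℤ) := by push_cast; rfl
    rw [e, esym_eq_schur_col h, schur_mul_esym, ← Finset.sum_insert]
    · congr 1
      ext m
      rw [Finset.mem_insert, mem_strips_col h (by push_cast; omega),
        mem_strips_col h3 (by exact_mod_cast h1)]
      constructor
      · rintro (rfl | ⟨hm, hs, hc⟩)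
        · exact ⟨hmu, by rw [h2]; push_cast; rfl, le_rfl⟩
        · push_cast at hs
          exact ⟨hm, by rw [hs]; ring, by omega⟩
      · rintro ⟨hm, hs, hc⟩
        by_cases hmc : m.conj 0 = mu.conj 0
        · left
          have := Part.size_eq_conj_add_conj hm
          exact Part.ext_of_conj hm hmu hmc (by omega)
        · right
          refine ⟨hm, ?_, by omega⟩
          rw [hs]
          push_cast
          ring
    · rw [mem_strips_col h (by push_cast; omega)]
      rintro ⟨-, -, h⟩
      omega
  · have e : ((mu.conj 0 : ℤ) + 1) = ((mu.conj 0 + 1 : ℕ) : ℤ) := by push_cast; rfl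
    rw [e, esym_of_lt (not_le.1 h), zero_mul, add_zero, ← Finset.sum_singleton schur mu]
    congr 1
    ext m
    rw [Finset.mem_singleton, mem_strips_col h3 (by exact_mod_cast h1)]
    constructor
    · rintro rfl
      exact ⟨hmu, by rw [h2]; push_cast; rfl, le_rfl⟩
    · rintro ⟨hm, hs, hc⟩
      have := Part.size_eq_conj_add_conj hm
      have := m.conj_le 0
      exact Part.ext_of_conj hm hmu (by omega) (by omega)

/-! ### Littlewood–Richardson coefficients -/

open Classical in
/-- The middle terms `κ` satisfying `p` of the chains `λ ⊆ κ ⊆ ν` of vertical strips of lengths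
`a` and `b`. -/
def chains {n : ℕ} (p : Part n → Prop) (l nu : Part n) (a b : ℤ) : Finset (Part n) :=
  (strips l a).filter fun m => p m ∧ nu ∈ strips m b

theorem mem_chains {n : ℕ} {p : Part n → Prop} {l m nu : Part n} {a b : ℤ} :
    m ∈ chains p l nu a b ↔ m ∈ strips l a ∧ p m ∧ nu ∈ strips m b := by
  classical
  exact Finset.mem_filter

/-- The number of chains `λ ⊆ κ ⊆ ν` of vertical strips of lengths `a` and `b` whose middle term
satisfies `p`. -/
def chainCount {n : ℕ} (p : Part n → Prop) (l nu : Part n) (a b : ℤ) : ℕ :=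
  (chains p l nu a b).card

theorem schurCoeff_sum_strips {n : ℕ} (l nu : Part n) (a b : ℤ) :
    schurCoeff nu (schur l * (esym n a * esym n b)) = chainCount (fun _ => True) l nu a b := by
  classical
  rw [← mul_assoc, schur_mul_esym, Finset.sum_mul, map_sum, chainCount, chains, Finset.card_filter]
  push_cast
  refine Finset.sum_congr rfl fun m _ => ?_
  rw [schur_mul_esym, map_sum]
  simp [schurCoeff_schur]

theorem lrCoeff_eq {n : ℕ} (l nu : Part n) {mu : Part n} (hmu : ∀ i, mu.1 i ≤ 2) :
    lrCoeff l mu nu = (chainCount (fun _ => True) l nu (mu.conj 0) (mu.conj 1) : ℚ) -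
      chainCount (fun _ => True) l nu (mu.conj 0 + 1) (mu.conj 1 - 1) := by
  rw [lrCoeff, structureConstant_eq (isLinearBasis_schur n) (schurCoeff nu) l mu nu
    (by simp [schurCoeff_schur]) (fun m hm => by simp [schurCoeff_schur, hm]),
    schur_eq_esym hmu, mul_sub, map_sub, schurCoeff_sum_strips, schurCoeff_sum_strips]

/-! ### Spanning set of the fusion algebra -/

/-- The class of `s_λ` in the fusion algebra. -/
def fusionClass {n : ℕ} (k : ℕ) [NeZero n] (l : Part n) : FusionAlgebra n k :=
  Ideal.Quotient.mk (fusionIdeal n k) (schur l)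

theorem fusionClass_eq_zero {n k : ℕ} [NeZero n] {l : Part n} (h : l.width = k + 1) :
    fusionClass k l = 0 :=
  Ideal.Quotient.eq_zero_iff_mem.2 (Ideal.subset_span (Or.inl ⟨l, h, rfl⟩))

/-- The partition obtained by adding `c` full columns. -/
def Part.shift {n : ℕ} (l : Part n) (c : ℕ) : Part n :=
  ⟨fun i => l.1 i + c, fun _ _ h => Nat.add_le_add_right (l.2 h) c⟩

theorem strips_full {n : ℕ} (l : Part n) : strips l n = {l.shift 1} := by
  ext m
  rw [mem_strips, Finset.mem_singleton]
  have hs : (l.shift 1).size = l.size + n := by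
    simp [Part.size, Part.shift, Finset.sum_add_distrib]
  constructor
  · rintro ⟨h, hm⟩
    have h1 : ∑ i, m.1 i = ∑ i, (l.shift 1).1 i := by
      have : m.size = (l.shift 1).size := by omega
      exact this
    ext i
    exact (Finset.sum_eq_sum_iff_of_le fun i _ => (h i).2).1 h1 i (Finset.mem_univ i)
  · rintro rfl
    exact ⟨fun i => ⟨by simp [Part.shift], by simp [Part.shift]⟩, by rw [hs]; push_cast; rfl⟩

theorem col_self (n : ℕ) : Part.col n n = Part.ones n := by
  ext i
  simp [Part.col, Part.ones]

theorem schur_shift_one {n : ℕ} (l : Part n) :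
    schur (l.shift 1) = schur l * schur (Part.ones n) := by
  rw [← col_self, ← esym_eq_schur_col le_rfl, schur_mul_esym, strips_full, Finset.sum_singleton]

theorem fusionClass_shift {n : ℕ} (k : ℕ) [NeZero n] (l : Part n) (c : ℕ) :
    fusionClass k (l.shift c) = fusionClass k l := by
  induction c with
  | zero => rfl
  | succ c ih =>
    have h1 : l.shift (c + 1) = (l.shift c).shift 1 := rfl
    have h2 : Ideal.Quotient.mk (fusionIdeal n k) (schur (Part.ones n)) = 1 := by
      rw [← map_one (Ideal.Quotient.mk (fusionIdeal n k)), Ideal.Quotient.eq]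
      exact Ideal.subset_span (Or.inr rfl)
    rw [h1, fusionClass, schur_shift_one, map_mul, h2, mul_one]
    exact ih

theorem RestrictedPart.shift_reduce {n k : ℕ} [NeZero n] (l : RestrictedPart n k) :
    l.reduce.1.shift (l.1.1 (Fin.rev 0)) = l.1 := by
  ext i
  refine Nat.sub_add_cancel (l.1.2 ?_)
  rw [Fin.le_def, Fin.val_rev]
  have := i.2
  simp
  omega

theorem fusionClass_eq_fusionSchur {n k : ℕ} [NeZero n] (l : RestrictedPart n k) :
    fusionClass k l.1 = fusionSchur n k l.reduce := by
  conv_lhs => rw [← l.shift_reduce]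
  exact fusionClass_shift k _ _

theorem VerticalStrip.width_le {n : ℕ} [NeZero n] {l m : Part n} (h : VerticalStrip l m) :
    m.width ≤ l.width + 1 := by
  have h1 := (h 0).2
  have h2 := (h (Fin.rev 0)).1
  simp only [Part.width]
  omega

/-- The Pieri rule in the fusion algebra. -/
theorem fusionClass_mul_esym {n k : ℕ} [NeZero n] {l : Part n} (hl : l.width ≤ k) (j : ℤ) :
    fusionClass k l * Ideal.Quotient.mk (fusionIdeal n k) (esym n j) =
      ∑ m ∈ strips l j with m.width ≤ k, fusionClass k m := by
  rw [fusionClass, ← map_mul, schur_mul_esym, map_sum, Finset.sum_filter]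
  refine Finset.sum_congr rfl fun m hm => ?_
  split_ifs with h
  · rfl
  · have := (mem_strips.1 hm).1.width_le
    exact fusionClass_eq_zero (by omega)

theorem span_fusionSchur (n k : ℕ) [NeZero n] :
    Submodule.span ℚ (Set.range (fusionSchur n k)) = ⊤ := by
  refine span_eq_top_of_esym_mul_mem _ _ ?_ ?_
  · refine Submodule.subset_span ⟨⟨Part.zero n, rfl, Nat.zero_le _⟩, ?_⟩
    rw [fusionSchur, schur_zero, map_one]
  · intro j v hv
    induction hv using Submodule.span_induction with
    | mem x hx =>
      obtain ⟨l, rfl⟩ := hx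
      have hl : l.1.width ≤ k := (Nat.sub_le _ _).trans l.2.2
      change fusionClass k l.1 * _ ∈ _
      rw [fusionClass_mul_esym hl]
      refine Submodule.sum_mem _ fun m hm => Submodule.subset_span ?_
      exact ⟨_, (fusionClass_eq_fusionSchur ⟨m, (Finset.mem_filter.1 hm).2⟩).symm⟩
    | zero => rw [zero_mul]; exact Submodule.zero_mem _
    | add x y _ _ hx hy => rw [add_mul]; exact Submodule.add_mem _ hx hy
    | smul a x _ hx => rw [smul_mul_assoc]; exact Submodule.smul_mem _ _ hx

/-! ### Linear independence in the fusion algebra -/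

/-- Integral weights modulo `N` times the root lattice and modulo the vector `(1, …, 1)`. -/
def weightSubgroup (n N : ℕ) : AddSubgroup (Fin n → ℤ) where
  carrier := {z | ∃ (q : Fin n → ℤ) (c : ℤ), ∑ i, q i = 0 ∧ ∀ i, z i = N * q i + c}
  zero_mem' := ⟨0, 0, by simp, by simp⟩
  add_mem' := by
    rintro z w ⟨q, c, hq, hz⟩ ⟨q', c', hq', hw⟩
    refine ⟨q + q', c + c', by simp [Finset.sum_add_distrib, hq, hq'], fun i => ?_⟩
    simp only [Pi.add_apply, hz, hw]
    ring
  neg_mem' := by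
    rintro z ⟨q, c, hq, hz⟩
    refine ⟨-q, -c, by simp [hq], fun i => ?_⟩
    simp only [Pi.neg_apply, hz]
    ring

/-- Two points of the open fundamental alcove in the same orbit of the affine symmetric group
differ by a multiple of `(1, …, 1)`. -/
theorem alcove_unique {n N : ℕ} {a b : Fin n → ℤ} (ha : StrictAnti a) (hb : StrictAnti b)
    (haN : ∀ i j, a i - a j < N) (hbN : ∀ i j, b i - b j < N) {σ : Equiv.Perm (Fin n)}
    (h : a ∘ σ - b ∈ weightSubgroup n N) : σ = 1 ∧ ∃ c, ∀ i, a i = b i + c := by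
  obtain ⟨q, c, hq, hz⟩ := h
  have hq0 : ∀ i, q i = 0 := by
    by_contra hne
    push Not at hne
    obtain ⟨i₀, hi₀⟩ := hne
    -- A nonzero `q` with sum zero has an entry at least `1` and an entry at most `-1`. Then `a (σ
    -- i) - a (σ j) = b i - b j + N (q i - q j) > -N + 2N`, against `haN`.
    obtain ⟨i, -, hi⟩ := Finset.exists_pos_of_sum_zero_of_exists_nonzero q hq
      ⟨i₀, Finset.mem_univ _, hi₀⟩
    obtain ⟨j, -, hj⟩ := Finset.exists_pos_of_sum_zero_of_exists_nonzero (-q) (s := Finset.univ)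
      (by simp [hq]) ⟨i₀, Finset.mem_univ _, by simpa using hi₀⟩
    have h1 := hz i
    have h2 := hz j
    simp only [Pi.sub_apply, Function.comp_apply, Pi.neg_apply] at h1 h2 hj
    have h3 := haN (σ i) (σ j)
    have h4 := hbN j i
    have h5 : (N : ℤ) * q i ≥ N * 1 := by gcongr; omega
    have h6 : (N : ℤ) * (-q j) ≥ N * 1 := by gcongr; omega
    linarith
  have hab : ∀ i, a (σ i) = b i + c := fun i => by
    have := hz i
    simp only [Pi.sub_apply, Function.comp_apply, hq0, mul_zero, zero_add] at this
    linarith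
  have hσ : σ = 1 := perm_eq_one_of_strictAnti ha fun i j hij => by
    simp only [Function.comp_apply, hab]
    have := hb hij
    linarith
  refine ⟨hσ, c, fun i => ?_⟩
  have := hab i
  rwa [hσ] at this

/-- The group algebra of the group of weights modulo `weightSubgroup`. -/
abbrev WeightAlgebra (n N : ℕ) : Type :=
  AddMonoidAlgebra ℚ ((Fin n → ℤ) ⧸ weightSubgroup n N)

/-- The class of a weight in the group algebra. -/
def weightExp {n : ℕ} (N : ℕ) (z : Fin n → ℤ) : WeightAlgebra n N :=
  AddMonoidAlgebra.single (QuotientAddGroup.mk z) 1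

theorem weightExp_add {n N : ℕ} (z w : Fin n → ℤ) :
    weightExp N (z + w) = weightExp N z * weightExp N w := by
  simp [weightExp, AddMonoidAlgebra.single_mul_single]

theorem weightExp_eq_iff {n N : ℕ} (z w : Fin n → ℤ) :
    weightExp N z = weightExp N w ↔ z - w ∈ weightSubgroup n N := by
  rw [weightExp, weightExp, ← QuotientAddGroup.eq_iff_sub_mem]
  constructor
  · intro h
    have := congrArg AddMonoidAlgebra.coeff h
    exact (Finsupp.single_left_inj one_ne_zero).1 this
  · intro h
    rw [h]

theorem weightExp_zero (n N : ℕ) : weightExp N (0 : Fin n → ℤ) = 1 := rfl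

theorem weightExp_nsmul {n N : ℕ} (c : ℕ) (z : Fin n → ℤ) :
    weightExp N (c • z) = weightExp N z ^ c := by
  induction c with
  | zero => rw [zero_smul, pow_zero, weightExp_zero]
  | succ c ih => rw [succ_nsmul, weightExp_add, ih, pow_succ]

theorem weightExp_sum {n N : ℕ} {ι : Type*} (s : Finset ι) (z : ι → Fin n → ℤ) :
    weightExp N (∑ i ∈ s, z i) = ∏ i ∈ s, weightExp N (z i) := by
  classical
  induction s using Finset.induction_on with
  | empty => rw [Finset.sum_empty, Finset.prod_empty, weightExp_zero]
  | insert i s hi ih => rw [Finset.sum_insert hi, Finset.prod_insert hi, weightExp_add, ih]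

/-- The algebra homomorphism that reduces exponents modulo `weightSubgroup`. -/
def weightHom (n N : ℕ) : MvPolynomial (Fin n) ℚ →ₐ[ℚ] WeightAlgebra n N :=
  aeval fun i => weightExp N (Pi.single i 1)

theorem weightHom_X {n : ℕ} (N : ℕ) (i : Fin n) :
    weightHom n N (X i) = weightExp N (Pi.single i 1) := by
  simp [weightHom]

theorem weightHom_prod {n : ℕ} (N : ℕ) (a : Fin n → ℕ) (σ : Equiv.Perm (Fin n)) :
    weightHom n N (∏ j, X (σ j) ^ a j) = weightExp N fun i => (a (σ.symm i) : ℤ) := by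
  simp only [map_prod, map_pow, weightHom_X, ← weightExp_nsmul]
  rw [← weightExp_sum]
  congr 1
  funext i
  rw [Finset.sum_apply, Finset.sum_eq_single (σ.symm i)]
  · simp
  · intro j _ hj
    simp [← Equiv.symm_apply_eq, hj.symm]
  · simp

theorem weightHom_X_pow {n : ℕ} (N : ℕ) (i j : Fin n) :
    weightHom n N (X i) ^ N = weightHom n N (X j) ^ N := by
  rw [weightHom_X, weightHom_X, ← weightExp_nsmul, ← weightExp_nsmul, weightExp_eq_iff]
  refine ⟨Pi.single i 1 - Pi.single j 1, 0, by simp, fun x => ?_⟩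
  simp [mul_sub]

/-- All `x_i ^ (n + k)` have the same image. Width `k + 1` makes the exponent of the first column
exceed that of the last by exactly `n + k`, so these columns become proportional. -/
theorem weightHom_alternant_eq_zero {n k : ℕ} [NeZero n] {l : Part n} (h : l.width = k + 1) :
    weightHom n (n + k) (alternant (l.1 + delta n)) = 0 := by
  rw [alternant, AlgHom.map_det]
  set M := (weightHom n (n + k)).mapMatrix
    (Matrix.of fun i j : Fin n => (X i : MvPolynomial (Fin n) ℚ) ^ (l.1 + delta n) j) with hM
  have hne : (0 : Fin n) ≠ Fin.rev 0 := by
    intro h0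
    rw [Part.width, ← h0, Nat.sub_self] at h
    omega
  have hMij : ∀ i j, M i j = weightHom n (n + k) (X i) ^ (l.1 j + (n - 1 - j)) := fun i j => by
    simp [hM, delta]
  have hcol : M = M.updateCol 0
      (weightHom n (n + k) (X 0) ^ (n + k) • fun i => M i (Fin.rev 0)) := by
    ext1 i j
    by_cases hj : j = 0
    · subst hj
      rw [Matrix.updateCol_self, Pi.smul_apply, smul_eq_mul, hMij, hMij,
        weightHom_X_pow (n + k) 0 i, ← pow_add]
      congr 1
      have := NeZero.pos n
      rw [Part.width] at h
      simp only [Fin.val_rev, Fin.val_zero]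
      omega
    · rw [Matrix.updateCol_ne hj]
  rw [hcol, Matrix.det_updateCol_smul, Matrix.det_zero_of_column_eq hne, mul_zero]
  intro i
  rw [Matrix.updateCol_self, Matrix.updateCol_ne hne.symm]

theorem schurPoly_ones (n : ℕ) : schurPoly (Part.ones n) = ∏ i, X i := by
  have h : schur (Part.ones n) = esym n n := by rw [esym_eq_schur_col le_rfl, col_self]
  rw [esym_natCast] at h
  have h2 := congrArg Subtype.val h
  change schurPoly _ = esymm (Fin n) ℚ n at h2
  have h3 : Finset.powersetCard n (Finset.univ : Finset (Fin n)) = {Finset.univ} := by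
    have := Finset.powersetCard_self (Finset.univ : Finset (Fin n))
    rwa [Finset.card_univ, Fintype.card_fin] at this
  rw [h2, esymm, h3, Finset.sum_singleton]

/-- Consequently the functionals `weightCoeff` vanish on the fusion ideal and can test linear
independence in the quotient. -/
theorem weightHom_eq_zero_of_mem {n k : ℕ} [NeZero n] {f : SymPoly n} (hf : f ∈ fusionIdeal n k) :
    weightHom n (n + k) (alternant (delta n) * f.1) = 0 := by
  rw [fusionIdeal, Ideal.span] at hf
  induction hf using Submodule.span_induction with
  | mem x hx =>
    rcases hx with ⟨l, hl, rfl⟩ | rfl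
    · exact (congrArg _ (alternant_delta_mul_schurPoly l)).trans (weightHom_alternant_eq_zero hl)
    · have h1 : (schur (Part.ones n) - 1 : SymPoly n).1 = schurPoly (Part.ones n) - 1 := rfl
      have h2 := weightHom_prod (n + k) (fun _ : Fin n => 1) 1
      have h3 : weightExp (n + k) (fun _ : Fin n => (1 : ℤ)) = 1 := by
        rw [← weightExp_zero, weightExp_eq_iff]
        exact ⟨0, 1, by simp, by simp⟩
      simp only [pow_one, Equiv.Perm.one_apply, Nat.cast_one, h3] at h2
      rw [h1, schurPoly_ones, map_mul, map_sub, h2, map_one, sub_self, mul_zero]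
  | zero => simp
  | add x y _ _ hx hy =>
    have : (x + y : SymPoly n).1 = x.1 + y.1 := rfl
    rw [this, mul_add, map_add, hx, hy, add_zero]
  | smul a x _ hx =>
    have : (a • x : SymPoly n).1 = a.1 * x.1 := rfl
    rw [this, mul_left_comm, map_mul, hx, mul_zero]

/-- The coefficient of the weight `ν + δ`. -/
def weightCoeff {n : ℕ} (N : ℕ) (nu : Part n) : SymPoly n →ₗ[ℚ] ℚ where
  toFun f := (weightHom n N (alternant (delta n) * f.1)).coeff
    (QuotientAddGroup.mk fun i => ((nu.1 + delta n) i : ℤ))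
  map_add' f g := by
    have : (f + g : SymPoly n).1 = f.1 + g.1 := rfl
    rw [this, mul_add, map_add]
    rfl
  map_smul' c f := by
    have : (c • f : SymPoly n).1 = c • f.1 := rfl
    rw [this, mul_smul_comm, map_smul]
    rfl

theorem strictAnti_cast_add_delta {n : ℕ} (l : Part n) :
    StrictAnti fun i => ((l.1 + delta n) i : ℤ) := fun _ _ h =>
  Int.ofNat_lt.2 <| strictAnti_add_delta l h

theorem ReducedPart.add_delta_sub_lt {n k : ℕ} [NeZero n] (l : ReducedPart n k) (i j : Fin n) :
    ((l.1.1 + delta n) i : ℤ) - ((l.1.1 + delta n) j : ℤ) < (n + k : ℕ) := by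
  have h1 := l.1.2 (Fin.zero_le i)
  have h2 := l.2.2
  have := NeZero.pos n
  simp only [Pi.add_apply, delta]
  omega

-- Both shifted weights lie in the open fundamental alcove, so `alcove_unique` leaves only the
-- identity term. The remaining multiple of `(1, …, 1)` is zero because both last parts are zero.
open Classical in
theorem weightCoeff_schur {n k : ℕ} [NeZero n] (nu l : ReducedPart n k) :
    weightCoeff (n + k) nu.1 (schur l.1) = if l = nu then 1 else 0 := by
  have h1 : weightCoeff (n + k) nu.1 (schur l.1) = (weightHom n (n + k)
      (alternant (delta n) * schurPoly l.1)).coeff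
      (QuotientAddGroup.mk fun i => ((nu.1.1 + delta n) i : ℤ)) := rfl
  have key : ∀ σ : Equiv.Perm (Fin n),
      (QuotientAddGroup.mk fun i => ((l.1.1 + delta n) (σ.symm i) : ℤ) :
        (Fin n → ℤ) ⧸ weightSubgroup n (n + k)) =
        QuotientAddGroup.mk (fun i => ((nu.1.1 + delta n) i : ℤ)) → σ = 1 ∧ l = nu := by
    intro σ h
    rw [QuotientAddGroup.eq_iff_sub_mem] at h
    obtain ⟨h2, c, hc⟩ := alcove_unique (σ := σ.symm) (strictAnti_cast_add_delta l.1)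
      (strictAnti_cast_add_delta nu.1) l.add_delta_sub_lt nu.add_delta_sub_lt h
    have h3 := hc (Fin.rev 0)
    simp only [Pi.add_apply, l.2.1, nu.2.1] at h3
    have hc0 : c = 0 := by omega
    refine ⟨by rw [← Equiv.symm_symm σ, h2]; rfl, ?_⟩
    ext i
    have := hc i
    simp only [Pi.add_apply] at this
    omega
  rw [h1, alternant_delta_mul_schurPoly, alternant_eq_sum, map_sum, AddMonoidAlgebra.coeff_sum,
    Finsupp.finsetSum_apply]
  have hterm : ∀ σ : Equiv.Perm (Fin n), (weightHom n (n + k)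
      (((Equiv.Perm.sign σ : ℤ) : MvPolynomial (Fin n) ℚ) *
        ∏ j, X (σ j) ^ (l.1.1 + delta n) j)).coeff
          (QuotientAddGroup.mk fun i => ((nu.1.1 + delta n) i : ℤ)) =
      ((Equiv.Perm.sign σ : ℤ) : ℚ) * if (QuotientAddGroup.mk fun i =>
        ((l.1.1 + delta n) (σ.symm i) : ℤ) : (Fin n → ℤ) ⧸ weightSubgroup n (n + k)) =
        QuotientAddGroup.mk (fun i => ((nu.1.1 + delta n) i : ℤ)) then 1 else 0 := by
    intro σ
    rw [← map_intCast (C : ℚ →+* MvPolynomial (Fin n) ℚ), ← smul_eq_C_mul, map_smul,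
      weightHom_prod, AddMonoidAlgebra.coeff_smul_apply, smul_eq_mul]
    congr 1
    exact Finsupp.single_apply
  rw [Finset.sum_congr rfl fun σ _ => hterm σ, Finset.sum_eq_single 1]
  · by_cases hl : l = nu
    · subst hl
      rw [if_pos rfl]
      exact (congrArg _ (if_pos rfl)).trans (by simp)
    · rw [if_neg hl, if_neg fun h => hl (key 1 h).2, mul_zero]
  · intro σ _ hσ
    rw [if_neg fun h => hσ (key σ h).1, mul_zero]
  · simp

theorem linearIndependent_fusionSchur (n k : ℕ) [NeZero n] :
    LinearIndependent ℚ (fusionSchur n k) := by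
  classical
  rw [linearIndependent_iff']
  intro s g hg i hi
  have h1 : Ideal.Quotient.mk (fusionIdeal n k) (∑ l ∈ s, g l • schur l.1) = 0 := by
    rw [← hg, map_sum]
    rfl
  have h2 : weightCoeff (n + k) i.1 (∑ l ∈ s, g l • schur l.1) = 0 := by
    have := weightHom_eq_zero_of_mem (Ideal.Quotient.eq_zero_iff_mem.1 h1)
    exact (congrArg (fun x : WeightAlgebra n (n + k) => x.coeff _) this)
  rw [map_sum] at h2
  simpa [weightCoeff_schur, hi] using h2

theorem isLinearBasis_fusionSchur (n k : ℕ) [NeZero n] : IsLinearBasis (fusionSchur n k) :=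
  ⟨linearIndependent_fusionSchur n k, span_fusionSchur n k⟩

/-! ### Fusion coefficients -/

theorem IsLinearBasis.exists_dual {ι A : Type} [CommRing A] [Algebra ℚ A] {b : ι → A}
    (hb : IsLinearBasis b) (l : ι) :
    ∃ φ : A →ₗ[ℚ] ℚ, φ (b l) = 1 ∧ ∀ m, m ≠ l → φ (b m) = 0 := by
  classical
  refine ⟨(Module.Basis.mk hb.1 hb.2.ge).coord l, ?_, fun m hm => ?_⟩
  · rw [← Module.Basis.mk_apply hb.1 hb.2.ge l]
    simp only [Module.Basis.coord_apply, Module.Basis.repr_self, Finsupp.single_eq_same]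
  · rw [← Module.Basis.mk_apply hb.1 hb.2.ge m]
    simp only [Module.Basis.coord_apply, Module.Basis.repr_self, Finsupp.single_apply, if_neg hm]

theorem Part.size_shift {n : ℕ} (l : Part n) (c : ℕ) : (l.shift c).size = l.size + n * c := by
  simp [Part.size, Part.shift, Finset.sum_add_distrib]

theorem RestrictedPart.eq_of_reduce_eq {n k : ℕ} [NeZero n] {l m : RestrictedPart n k}
    (h : l.reduce = m.reduce) (hs : l.1.size = m.1.size) : l = m := by
  have h1 := l.shift_reduce
  have h2 := m.shift_reduce
  have h3 := congrArg Part.size h1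
  have h4 := congrArg Part.size h2
  rw [Part.size_shift] at h3 h4
  rw [h] at h3 h1
  have h5 : l.1.1 (Fin.rev 0) = m.1.1 (Fin.rev 0) :=
    Nat.eq_of_mul_eq_mul_left (NeZero.pos n) (by omega)
  apply Subtype.ext
  rw [← h1, ← h2, h5]

theorem chainCount_eq_zero {n : ℕ} (p : Part n → Prop) {l nu : Part n} {a b : ℤ}
    (h : (nu.size : ℤ) ≠ l.size + (a + b)) : chainCount p l nu a b = 0 := by
  classical
  rw [chainCount, Finset.card_eq_zero, Finset.eq_empty_iff_forall_notMem]
  intro m hmem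
  obtain ⟨hm, -, hnu⟩ := mem_chains.1 hmem
  rw [mem_strips] at hm hnu
  omega

theorem dual_fusionClass_mul {n k : ℕ} [NeZero n] (lam nu : RestrictedPart n k)
    {φ : FusionAlgebra n k →ₗ[ℚ] ℚ} (h1 : φ (fusionSchur n k nu.reduce) = 1)
    (h0 : ∀ m, m ≠ nu.reduce → φ (fusionSchur n k m) = 0) {a b : ℤ}
    (hs : (nu.1.size : ℤ) = lam.1.size + (a + b)) :
    φ (fusionClass k lam.1 * (Ideal.Quotient.mk (fusionIdeal n k) (esym n a) *
      Ideal.Quotient.mk (fusionIdeal n k) (esym n b))) =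
      chainCount (fun m => m.width ≤ k) lam.1 nu.1 a b := by
  classical
  rw [← mul_assoc, fusionClass_mul_esym lam.2, Finset.sum_mul, map_sum, chainCount, chains,
    Finset.card_filter, Finset.sum_filter]
  push_cast
  refine Finset.sum_congr rfl fun m hm => ?_
  by_cases hw : m.width ≤ k
  swap
  · simp [hw]
  rw [if_pos hw, fusionClass_mul_esym hw, map_sum]
  -- The functional sees only reduced partitions, but `m'` has as many boxes as `nu`, so equal
  -- reductions force equality.
  have hφ : ∀ m' ∈ (strips m b).filter fun m' => m'.width ≤ k,
      φ (fusionClass k m') = if m' = nu.1 then 1 else 0 := by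
    intro m' hm'
    rw [Finset.mem_filter, mem_strips] at hm'
    have hm1 := (mem_strips.1 hm).2
    have e : fusionClass k m' = _ := fusionClass_eq_fusionSchur ⟨m', hm'.2⟩
    rw [e]
    split_ifs with h
    · rw [← h1]
      congr 3
      exact Subtype.ext h
    · refine h0 _ fun hr => h ?_
      exact congrArg Subtype.val (RestrictedPart.eq_of_reduce_eq hr (by
        have := hm'.1.2
        change m'.size = nu.1.size
        omega))
  rw [Finset.sum_congr rfl hφ, Finset.sum_ite_eq']
  simp [nu.2, hw]

theorem fusionCoeff_eq {n k : ℕ} [NeZero n] (lam mu nu : RestrictedPart n k)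
    (hmu : ∀ i, mu.1.1 i ≤ 2) : fusionCoeff lam mu nu =
      (chainCount (fun m => m.width ≤ k) lam.1 nu.1 (mu.1.conj 0) (mu.1.conj 1) : ℚ) -
      chainCount (fun m => m.width ≤ k) lam.1 nu.1 (mu.1.conj 0 + 1) (mu.1.conj 1 - 1) := by
  have hs := Part.size_eq_conj_add_conj hmu
  rw [fusionCoeff]
  split_ifs with h
  · obtain ⟨φ, h1, h0⟩ := (isLinearBasis_fusionSchur n k).exists_dual nu.reduce
    rw [structureConstant_eq (isLinearBasis_fusionSchur n k) φ _ _ _ h1 h0,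
      ← fusionClass_eq_fusionSchur, ← fusionClass_eq_fusionSchur]
    have e : fusionClass k mu.1 = Ideal.Quotient.mk (fusionIdeal n k) (esym n (mu.1.conj 0)) *
        Ideal.Quotient.mk (fusionIdeal n k) (esym n (mu.1.conj 1)) -
        Ideal.Quotient.mk (fusionIdeal n k) (esym n (mu.1.conj 0 + 1)) *
        Ideal.Quotient.mk (fusionIdeal n k) (esym n (mu.1.conj 1 - 1)) := by
      rw [fusionClass, schur_eq_esym hmu, map_sub, map_mul, map_mul]
    rw [e, mul_sub, map_sub, dual_fusionClass_mul lam nu h1 h0 (by omega),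
      dual_fusionClass_mul lam nu h1 h0 (by omega)]
  · rw [chainCount_eq_zero _ (by omega), chainCount_eq_zero _ (by omega)]
    simp

theorem chainCount_add_not {n : ℕ} (p : Part n → Prop) (l nu : Part n) (a b : ℤ) :
    chainCount (fun _ => True) l nu a b =
      chainCount p l nu a b + chainCount (fun m => ¬ p m) l nu a b := by
  classical
  simp only [chainCount, chains, true_and]
  rw [← Finset.card_filter_add_card_filter_not (s := (strips l a).filter fun m => nu ∈ strips m b) p,
    Finset.filter_filter, Finset.filter_filter]
  simp only [and_comm]

/-- The difference of the Littlewood–Richardson and the fusion coefficient is a signed count of the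
chains that leave the set of restricted partitions. -/
theorem lrCoeff_sub_fusionCoeff {n k : ℕ} [NeZero n] (lam mu nu : RestrictedPart n k)
    (hmu : ∀ i, mu.1.1 i ≤ 2) : lrCoeff lam.1 mu.1 nu.1 - fusionCoeff lam mu nu =
      (chainCount (fun m => ¬ m.width ≤ k) lam.1 nu.1 (mu.1.conj 0) (mu.1.conj 1) : ℚ) -
      chainCount (fun m => ¬ m.width ≤ k) lam.1 nu.1 (mu.1.conj 0 + 1) (mu.1.conj 1 - 1) := by
  rw [lrCoeff_eq _ _ hmu, fusionCoeff_eq _ _ _ hmu,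
    chainCount_add_not (fun m => m.width ≤ k) lam.1 nu.1 (mu.1.conj 0) (mu.1.conj 1),
    chainCount_add_not (fun m => m.width ≤ k) lam.1 nu.1 (mu.1.conj 0 + 1) (mu.1.conj 1 - 1)]
  push_cast
  ring

end Fusion

end

noncomputable section

namespace Fusion

/-! ### Unimodality -/

/-- Symmetry about `c / 2` and monotonicity on either side. -/
def SymmUnimodal (c : ℤ) (f : ℤ → ℕ) : Prop :=
  (∀ x, f (c - x) = f x) ∧ ∀ x, c ≤ 2 * x + 1 → f (x + 1) ≤ f x

theorem SymmUnimodal.le {c : ℤ} {f : ℤ → ℕ} (h : SymmUnimodal c f) {x y : ℤ} (hxy : x ≤ y)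
    (hc : c ≤ x + y) : f y ≤ f x := by
  have key : ∀ x y : ℤ, x ≤ y → c ≤ 2 * x + 1 → f y ≤ f x := by
    intro x y hxy hx
    induction y, hxy using Int.leInduction with
    | base => exact le_rfl
    | succ y hy ih => exact (h.2 y (by omega)).trans ih
  by_cases hx : c ≤ 2 * x + 1
  · exact key x y hxy hx
  · rw [← h.1 x]
    exact key _ _ (by omega) (by omega)

/-- Symmetry comes from the reflection `j ↦ l + u - j`. Between `x` and `x + 1` the window sums
share all terms but one, which reduces monotonicity to `f (x + 1 - l) ≤ f (x - u)`. -/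
theorem SymmUnimodal.sum_shift {c : ℤ} {f : ℤ → ℕ} (h : SymmUnimodal c f) (l u : ℕ) :
    SymmUnimodal (c + (l + u)) fun x => ∑ j ∈ Finset.Icc l u, f (x - j) := by
  refine ⟨fun x => ?_, fun x hx => ?_⟩
  · refine Finset.sum_nbij' (fun j => l + u - j) (fun j => l + u - j) ?_ ?_ ?_ ?_ ?_
    · intro j hj
      rw [Finset.mem_Icc] at hj ⊢
      omega
    · intro j hj
      rw [Finset.mem_Icc] at hj ⊢
      omega
    · intro j hj
      rw [Finset.mem_Icc] at hj
      omega
    · intro j hj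
      rw [Finset.mem_Icc] at hj
      omega
    · intro j hj
      rw [Finset.mem_Icc] at hj
      rw [← h.1]
      congr 1
      push_cast [show j ≤ l + u by omega]
      ring
  · dsimp only
    rcases lt_or_ge u l with hul | hul
    · simp [Finset.Icc_eq_empty (not_le.2 hul)]
    rw [← Finset.sum_Ioc_add_eq_sum_Icc hul, ← Finset.sum_Ico_add_eq_sum_Icc hul]
    refine add_le_add (le_of_eq ?_) (h.le (by omega) (by omega))
    refine Finset.sum_nbij' (fun j => j - 1) (fun j => j + 1) ?_ ?_ ?_ ?_ ?_
    · intro j hj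
      rw [Finset.mem_Ioc] at hj
      rw [Finset.mem_Ico]
      omega
    · intro j hj
      rw [Finset.mem_Ico] at hj
      rw [Finset.mem_Ioc]
      omega
    · intro j hj
      rw [Finset.mem_Ioc] at hj
      omega
    · intro j _
      omega
    · intro j hj
      rw [Finset.mem_Ioc] at hj
      congr 1
      push_cast [show 1 ≤ j by omega]
      ring

open Polynomial in
/-- The coefficients of a polynomial, extended by zero to negative exponents. -/
def intCoeff (p : ℕ[X]) (x : ℤ) : ℕ := if 0 ≤ x then p.coeff x.toNat else 0

open Polynomial in
theorem symmUnimodal_prod {ι : Type*} (s : Finset ι) (l u : ι → ℕ) :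
    SymmUnimodal (∑ v ∈ s, ((l v : ℤ) + u v))
      (intCoeff (∏ v ∈ s, ∑ j ∈ Finset.Icc (l v) (u v), (X : ℕ[X]) ^ j)) := by
  classical
  induction s using Finset.induction_on with
  | empty =>
    refine ⟨fun x => ?_, fun x hx => ?_⟩
    · simp only [Finset.sum_empty, Finset.prod_empty, intCoeff, coeff_one]
      split_ifs <;> omega
    · simp only [Finset.sum_empty, Finset.prod_empty, intCoeff, coeff_one] at hx ⊢
      split_ifs <;> omega
  | insert v s hv ih =>
    rw [Finset.sum_insert hv, Finset.prod_insert hv, add_comm, mul_comm]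
    convert ih.sum_shift (l v) (u v) using 1
    funext x
    simp only [intCoeff, Finset.mul_sum, finsetSum_coeff, coeff_mul_X_pow']
    split_ifs with hx
    · refine Finset.sum_congr rfl fun j _ => ?_
      split_ifs with h1 h2 h2
      · congr 1
        omega
      · omega
      · omega
      · rfl
    · rw [Finset.sum_eq_zero]
      intro j _
      rw [if_neg (by omega)]

-- Lattice points of a box with coordinate sum `b` are counted by the coefficient of `X ^ b` in the
-- product of the `∑ X ^ j`. The hypothesis puts `a` on the descending side of the centre.
open Polynomial in
theorem card_piFinset_Icc_le {ι : Type*} [Fintype ι] [DecidableEq ι] (l u : ι → ℕ) (a : ℕ)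
    (h : ∑ v, l v + ∑ v, u v ≤ 2 * a + 1) :
    ((Fintype.piFinset fun v => Finset.Icc (l v) (u v)).filter fun p => ∑ v, p v = a + 1).card ≤
      ((Fintype.piFinset fun v => Finset.Icc (l v) (u v)).filter fun p => ∑ v, p v = a).card := by
  have key : ∀ b : ℕ, ((Fintype.piFinset fun v => Finset.Icc (l v) (u v)).filter
      fun p => ∑ v, p v = b).card =
      intCoeff (∏ v, ∑ j ∈ Finset.Icc (l v) (u v), (X : ℕ[X]) ^ j) b := by
    intro b
    rw [Finset.prod_univ_sum, intCoeff, if_pos (Int.natCast_nonneg b), Int.toNat_natCast,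
      finsetSum_coeff, Finset.card_filter]
    refine Finset.sum_congr rfl fun p _ => ?_
    rw [Finset.prod_pow_eq_pow_sum, coeff_X_pow]
    simp only [eq_comm]
  rw [key, key]
  have := (symmUnimodal_prod Finset.univ l u).2 a (by
    rw [Finset.sum_add_distrib]
    exact_mod_cast h)
  exact_mod_cast this

/-! ### Sets of rows that are initial in every block -/

/-- The set `S` meets each fibre of `f` in an initial segment. -/
def FiberLower {n : ℕ} {ι : Type*} (f : Fin n → ι) (S : Finset (Fin n)) : Prop :=
  ∀ i j, i ≤ j → f i = f j → j ∈ S → i ∈ S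

/-- The number of elements of the fibre of `i` that precede `i`. -/
def fiberRank {n : ℕ} {ι : Type*} [DecidableEq ι] (f : Fin n → ι) (i : Fin n) : ℕ :=
  (Finset.univ.filter fun j => j < i ∧ f j = f i).card

theorem fiberRank_lt {n : ℕ} {ι : Type*} [DecidableEq ι] {f : Fin n → ι} {i j : Fin n} (h : i < j)
    (hf : f i = f j) : fiberRank f i < fiberRank f j := by
  refine Finset.card_lt_card (Finset.ssubset_iff_of_subset ?_ |>.2 ⟨i, ?_, ?_⟩)
  · intro x hx
    simp only [Finset.mem_filter, Finset.mem_univ, true_and] at hx ⊢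
    exact ⟨hx.1.trans h, hx.2.trans hf⟩
  · simp [h, hf]
  · simp

theorem FiberLower.mem_iff {n : ℕ} {ι : Type*} [DecidableEq ι] {f : Fin n → ι}
    {S : Finset (Fin n)} (hS : FiberLower f S) (i : Fin n) :
    i ∈ S ↔ fiberRank f i < (S.filter fun j => f j = f i).card := by
  constructor
  · intro hi
    refine Finset.card_lt_card (Finset.ssubset_iff_of_subset ?_ |>.2 ⟨i, ?_, ?_⟩)
    · intro x hx
      simp only [Finset.mem_filter, Finset.mem_univ, true_and] at hx ⊢
      exact ⟨hS x i hx.1.le hx.2 hi, hx.2⟩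
    · simp [hi]
    · simp
  · intro h
    by_contra hi
    refine absurd h (not_lt.2 (Finset.card_le_card ?_))
    intro x hx
    simp only [Finset.mem_filter, Finset.mem_univ, true_and] at hx ⊢
    refine ⟨?_, hx.2⟩
    by_contra hxi
    exact hi (hS i x (not_lt.1 hxi) hx.2.symm hx.1)

theorem card_filter_fiberRank_lt {n : ℕ} {ι : Type*} [DecidableEq ι] (f : Fin n → ι) (v : ι) {c : ℕ}
    (hc : c ≤ (Finset.univ.filter fun j => f j = v).card) :
    (Finset.univ.filter fun j => fiberRank f j < c ∧ f j = v).card = c := by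
  set F := Finset.univ.filter fun j => f j = v with hF
  have hmem : ∀ {j}, j ∈ F ↔ f j = v := by simp [hF]
  have hinj : Set.InjOn (fiberRank f) F := by
    intro i hi j hj hij
    rw [Finset.mem_coe, hmem] at hi hj
    rcases lt_trichotomy i j with h | h | h
    · exact absurd hij (fiberRank_lt h (hi.trans hj.symm)).ne
    · exact h
    · exact absurd hij (fiberRank_lt h (hj.trans hi.symm)).ne'
  have himg : F.image (fiberRank f) = Finset.range F.card := by
    refine Finset.eq_of_subset_of_card_le ?_ ?_
    · intro x hx
      obtain ⟨i, hi, rfl⟩ := Finset.mem_image.1 hx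
      rw [Finset.mem_range]
      refine Finset.card_lt_card (Finset.ssubset_iff_of_subset ?_ |>.2 ⟨i, hi, by simp⟩)
      intro y hy
      simp only [Finset.mem_filter, Finset.mem_univ, true_and] at hy
      rw [hmem] at hi ⊢
      exact hy.2.trans hi
    · rw [Finset.card_image_of_injOn hinj, Finset.card_range]
  have e : (F.filter fun j => fiberRank f j < c).image (fiberRank f) = Finset.range c := by
    ext x
    simp only [Finset.mem_image, Finset.mem_filter, Finset.mem_range]
    constructor
    · rintro ⟨i, ⟨-, h⟩, rfl⟩
      exact h
    · intro hx
      have : x ∈ F.image (fiberRank f) := by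
        rw [himg, Finset.mem_range]
        omega
      obtain ⟨i, hi, rfl⟩ := Finset.mem_image.1 this
      exact ⟨i, ⟨hi, hx⟩, rfl⟩
  have h1 := Finset.card_image_of_injOn (s := F.filter fun j => fiberRank f j < c)
    (hinj.mono (Finset.coe_subset.2 (Finset.filter_subset _ _)))
  rw [e, Finset.card_range, hF, Finset.filter_filter] at h1
  simp only [and_comm] at h1 ⊢
  exact h1.symm

open Classical in
/-- The number of sets of `a` rows between `A` and `B` that are initial in every fibre. -/
def lowerCount {n : ℕ} {ι : Type*} (f : Fin n → ι) (A B : Finset (Fin n)) (a : ℕ) : ℕ :=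
  (Finset.univ.filter fun S => (A ⊆ S ∧ S ⊆ B) ∧ FiberLower f S ∧ S.card = a).card

/-- A set that is initial in every fibre is determined by its fibre sizes, and inclusion of such
sets is comparison of sizes. So the sets between `A` and `B` are the lattice points of a box. -/
theorem lowerCount_eq {n : ℕ} {ι : Type*} [Fintype ι] [DecidableEq ι] {f : Fin n → ι}
    {A B : Finset (Fin n)} (hA : FiberLower f A) (hB : FiberLower f B) (a : ℕ) :
    lowerCount f A B a = ((Fintype.piFinset fun v => Finset.Icc
      (A.filter fun j => f j = v).card (B.filter fun j => f j = v).card).filter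
        fun p => ∑ v, p v = a).card := by
  classical
  have hcard : ∀ p ∈ Fintype.piFinset (fun v => Finset.Icc
      (A.filter fun j => f j = v).card (B.filter fun j => f j = v).card), ∀ v,
      ((Finset.univ.filter fun i => fiberRank f i < p (f i)).filter fun j => f j = v).card
        = p v := by
    intro p hp v
    rw [Fintype.mem_piFinset] at hp
    rw [Finset.filter_filter]
    have h1 := card_filter_fiberRank_lt f v (c := p v) ((Finset.mem_Icc.1 (hp v)).2.trans
      (Finset.card_le_card (Finset.filter_subset_filter _ (Finset.subset_univ _))))
    refine Eq.trans (congrArg Finset.card (Finset.filter_congr fun i _ => ?_)) h1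
    exact and_congr_left fun h => by rw [h]
  have hlower : ∀ p : ι → ℕ, FiberLower f (Finset.univ.filter fun i => fiberRank f i < p (f i)) := by
    intro p i j hij hf hj
    simp only [Finset.mem_filter, Finset.mem_univ, true_and] at hj ⊢
    rcases hij.lt_or_eq with h | rfl
    · have := fiberRank_lt h hf
      rw [hf]
      omega
    · exact hj
  refine Finset.card_nbij' (fun S v => (S.filter fun j => f j = v).card)
    (fun p => Finset.univ.filter fun i => fiberRank f i < p (f i)) ?_ ?_ ?_ ?_
  · intro S hS
    simp only [Finset.coe_filter, Finset.mem_univ, true_and, Set.mem_ofPred_eq] at hS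
    obtain ⟨⟨hAS, hSB⟩, hl, hc⟩ := hS
    simp only [Finset.coe_filter, Set.mem_ofPred_eq, Fintype.mem_piFinset, Finset.mem_Icc]
    refine ⟨fun v => ⟨Finset.card_le_card (Finset.filter_subset_filter _ hAS),
      Finset.card_le_card (Finset.filter_subset_filter _ hSB)⟩, ?_⟩
    rw [← hc]
    exact (Finset.card_eq_sum_card_fiberwise (t := Finset.univ) (f := f)
      (fun _ _ => by simp)).symm
  · intro p hp
    simp only [Finset.coe_filter, Set.mem_ofPred_eq] at hp
    obtain ⟨hp, hs⟩ := hp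
    have hp' := Fintype.mem_piFinset.1 hp
    simp only [Finset.coe_filter, Finset.mem_univ, true_and, Set.mem_ofPred_eq]
    refine ⟨⟨?_, ?_⟩, hlower p, ?_⟩
    · intro i hi
      have := (Finset.mem_Icc.1 (hp' (f i))).1
      rw [hA.mem_iff] at hi
      simp only [Finset.mem_filter, Finset.mem_univ, true_and]
      omega
    · intro i hi
      have := (Finset.mem_Icc.1 (hp' (f i))).2
      simp only [Finset.mem_filter, Finset.mem_univ, true_and] at hi
      rw [hB.mem_iff]
      omega
    · rw [Finset.card_eq_sum_card_fiberwise (t := Finset.univ) (f := f) (fun _ _ => by simp), ← hs]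
      exact Finset.sum_congr rfl fun v _ => hcard p hp v
  · intro S hS
    simp only [Finset.coe_filter, Finset.mem_univ, true_and, Set.mem_ofPred_eq] at hS
    ext i
    simp only [Finset.mem_filter, Finset.mem_univ, true_and]
    exact (hS.2.1.mem_iff i).symm
  · intro p hp
    simp only [Finset.coe_filter, Set.mem_ofPred_eq] at hp
    funext v
    exact hcard p hp.1 v

theorem lowerCount_succ_le {n : ℕ} {ι : Type*} {f : Fin n → ι}
    {A B : Finset (Fin n)} (hA : FiberLower f A) (hB : FiberLower f B) {a : ℕ}
    (h : A.card + B.card ≤ 2 * a + 1) : lowerCount f A B (a + 1) ≤ lowerCount f A B a := by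
  classical
  -- Passing to the range of `f` makes the index type of the fibres finite.
  have hiff : ∀ S, FiberLower f S ↔ FiberLower (Set.rangeFactorization f) S := fun S => by
    simp [FiberLower, Set.rangeFactorization, Subtype.ext_iff]
  have hcount : ∀ b, lowerCount f A B b = lowerCount (Set.rangeFactorization f) A B b := fun b => by
    simp only [lowerCount, hiff]
  rw [hiff] at hA hB
  have := Fintype.ofFinite (Set.range f)
  rw [hcount, hcount, lowerCount_eq hA hB, lowerCount_eq hA hB]
  apply card_piFinset_Icc_le
  rw [← Finset.card_eq_sum_card_fiberwise (t := Finset.univ) (fun _ _ => by simp),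
    ← Finset.card_eq_sum_card_fiberwise (t := Finset.univ) (fun _ _ => by simp)]
  exact h

/-- Rows of `B \ S` are added smallest first. As `B` is initial in the fibres, all earlier rows of
the same fibre are then already in `S`. -/
theorem exists_fiberLower {n : ℕ} {ι : Type*} {f : Fin n → ι} {A B : Finset (Fin n)}
    (hA : FiberLower f A) (hB : FiberLower f B) (hAB : A ⊆ B) {a : ℕ} (h1 : A.card ≤ a)
    (h2 : a ≤ B.card) : ∃ S, A ⊆ S ∧ S ⊆ B ∧ FiberLower f S ∧ S.card = a := by
  induction a, h1 using Nat.le_induction with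
  | base => exact ⟨A, subset_rfl, hAB, hA, rfl⟩
  | succ a _ ih =>
    obtain ⟨S, hAS, hSB, hS, hc⟩ := ih (by omega)
    have hne : (B \ S).Nonempty := by
      rw [Finset.sdiff_nonempty]
      intro h
      have := Finset.card_le_card h
      omega
    have hmin := Finset.min'_mem _ hne
    set x := (B \ S).min' hne with hx
    rw [Finset.mem_sdiff] at hmin
    refine ⟨insert x S, hAS.trans (Finset.subset_insert _ _),
      Finset.insert_subset hmin.1 hSB, ?_, by rw [Finset.card_insert_of_notMem hmin.2, hc]⟩
    intro i j hij hf hj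
    rw [Finset.mem_insert] at hj ⊢
    rcases hj with rfl | hj
    · by_contra hi
      push Not at hi
      have := Finset.min'_le (B \ S) i (Finset.mem_sdiff.2 ⟨hB i _ hij hf hmin.1, hi.2⟩)
      exact hi.1 (le_antisymm hij this)
    · exact Or.inr (hS i j hij hf hj)

/-! ### Chains that leave the restricted partitions -/

/-- The rows in which `ν` exceeds `λ` by at least `c`. -/
def rowsGe {n : ℕ} (l nu : Part n) (c : ℕ) : Finset (Fin n) :=
  Finset.univ.filter fun i => l.1 i + c ≤ nu.1 i

theorem mem_rowsGe {n : ℕ} {l nu : Part n} {c : ℕ} {i : Fin n} :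
    i ∈ rowsGe l nu c ↔ l.1 i + c ≤ nu.1 i := by
  simp [rowsGe]

theorem fiberLower_rowsGe {n : ℕ} (l nu : Part n) (c : ℕ) : FiberLower l.1 (rowsGe l nu c) := by
  intro i j hij hl hj
  rw [mem_rowsGe] at hj ⊢
  have := nu.2 hij
  omega

theorem size_eq_add_card_rowsGe {n : ℕ} {l nu : Part n}
    (h : ∀ i, l.1 i ≤ nu.1 i ∧ nu.1 i ≤ l.1 i + 2) :
    nu.size = l.size + ((rowsGe l nu 2).card + (rowsGe l nu 1).card) := by
  simp only [Part.size, rowsGe, Finset.card_filter, ← Finset.sum_add_distrib]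
  refine Finset.sum_congr rfl fun i _ => ?_
  have := h i
  split_ifs <;> omega

theorem le_rev_zero {n : ℕ} [NeZero n] (i : Fin n) : i ≤ Fin.rev 0 := by
  rw [Fin.le_def, Fin.val_rev, Fin.val_zero]
  have := i.2
  omega

theorem antitone_add_ind {n : ℕ} (l : Part n) {S : Finset (Fin n)} (hS : FiberLower l.1 S) :
    Antitone (l.1 + ind S) := by
  intro i j hij
  have h1 := l.2 hij
  have h2 := ind_le_one S j
  have h3 := hS i j hij
  simp only [Pi.add_apply, ind] at h2 ⊢
  split_ifs with hj hi hi
  · omega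
  · have : l.1 i ≠ l.1 j := fun h => hi (h3 h hj)
    omega
  · omega
  · omega

/-- The numerical conditions under which some chain of two vertical strips from `λ` to `ν` leaves
the restricted partitions in the middle. -/
structure Leaves {n : ℕ} [NeZero n] (k : ℕ) (l nu : Part n) : Prop where
  between : ∀ i, l.1 i ≤ nu.1 i ∧ nu.1 i ≤ l.1 i + 2
  first : nu.1 0 = l.1 0 + 1
  last : nu.1 (Fin.rev 0) = l.1 (Fin.rev 0) + 1
  width : l.1 0 = l.1 (Fin.rev 0) + k

/-- Each strip changes a row by at most one box. To exceed width `k` and return, the first strip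
must hit the first row and miss the last, the second strip must do the opposite, and λ must already
have width `k`. -/
theorem Leaves.of_chain {n k : ℕ} [NeZero n] {l m nu : Part n} (hl : l.width ≤ k)
    (hnu : nu.width ≤ k) (h1 : VerticalStrip l m) (h2 : VerticalStrip m nu) (hm : ¬ m.width ≤ k) :
    Leaves k l nu := by
  have a1 := h1 0
  have a2 := h1 (Fin.rev 0)
  have a3 := h2 0
  have a4 := h2 (Fin.rev 0)
  have a5 := l.2 (le_rev_zero 0)
  have a6 := nu.2 (le_rev_zero 0)
  simp only [Part.width] at hl hnu hm
  refine ⟨fun i => ?_, by omega, by omega, by omega⟩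
  have b1 := h1 i
  have b2 := h2 i
  omega

/-- A chain is encoded by the rows of its first strip. Rows gaining two boxes must be among them and
rows gaining none must not; leaving the restricted partitions forces the first row in and the last
row out. The middle term is a partition exactly when the set is initial in each block of equal rows
of λ. -/
theorem Leaves.chainCount_eq {n k : ℕ} [NeZero n] {l nu : Part n} (h : Leaves k l nu) {x : ℕ}
    {y : ℤ} (hs : (nu.size : ℤ) = l.size + (x + y)) :
    chainCount (fun m => ¬ m.width ≤ k) l nu x y =
      lowerCount l.1 (insert 0 (rowsGe l nu 2)) ((rowsGe l nu 1).erase (Fin.rev 0)) x := by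
  classical
  have h0 := h.first
  have hL := h.last
  have hw := h.width
  refine Finset.card_bij (fun m _ => rowsGe l m 1) ?_ ?_ ?_
  · intro m hm
    rw [mem_chains, mem_strips, mem_strips] at hm
    obtain ⟨⟨h1, hs1⟩, hmk, h2, -⟩ := hm
    have a1 := h1 0
    have a2 := h1 (Fin.rev 0)
    have a3 := h2 0
    have a4 := h2 (Fin.rev 0)
    simp only [Part.width] at hmk
    rw [Finset.mem_filter]
    refine ⟨Finset.mem_univ _, ⟨?_, ?_⟩, fiberLower_rowsGe _ _ _, ?_⟩
    · rw [Finset.insert_subset_iff, mem_rowsGe]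
      refine ⟨by omega, fun i hi => ?_⟩
      rw [mem_rowsGe] at hi ⊢
      have := h2 i
      omega
    · intro i hi
      rw [mem_rowsGe] at hi
      rw [Finset.mem_erase, mem_rowsGe]
      refine ⟨?_, ?_⟩
      · rintro rfl
        omega
      · have := h2 i
        omega
    · have := size_eq_add_card_rowsGe (l := l) (nu := m) fun i => by
        have := h1 i
        omega
      have he : rowsGe l m 2 = ∅ := by
        rw [rowsGe, Finset.filter_eq_empty_iff]
        intro i _
        have := h1 i
        omega
      rw [he, Finset.card_empty] at this
      omega
  · intro m hm m' hm' he
    rw [mem_chains, mem_strips] at hm hm'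
    ext i
    have e := congrArg (i ∈ ·) he
    simp only [mem_rowsGe, eq_iff_iff] at e
    have := hm.1.1 i
    have := hm'.1.1 i
    omega
  · intro S hS
    rw [Finset.mem_filter] at hS
    obtain ⟨-, ⟨hA, hB⟩, hl, hc⟩ := hS
    rw [Finset.insert_subset_iff] at hA
    have hm1 : ∀ i, (l.1 + ind S) i = l.1 i + ind S i := fun i => rfl
    have hsz : Part.size (⟨l.1 + ind S, antitone_add_ind l hl⟩ : Part n) = l.size + x := by
      simp only [Part.size, Pi.add_apply, Finset.sum_add_distrib, sum_ind, hc]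
    refine ⟨⟨l.1 + ind S, antitone_add_ind l hl⟩, ?_, ?_⟩
    · rw [mem_chains, mem_strips, mem_strips]
      refine ⟨⟨fun i => ?_, by rw [hsz]; push_cast; rfl⟩, ?_, fun i => ?_,
        by rw [hsz, hs]; push_cast; ring⟩
      · have := ind_le_one S i
        dsimp only
        rw [hm1]
        omega
      · have e0 : ind S 0 = 1 := by simp [ind, hA.1]
        have eL : ind S (Fin.rev 0) = 0 := by
          rw [ind, if_neg]
          intro hi
          exact (Finset.mem_erase.1 (hB hi)).1 rfl
        simp only [Part.width, hm1, e0, eL]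
        omega
      · dsimp only
        rw [hm1]
        have := h.between i
        by_cases hi : i ∈ S
        · have := mem_rowsGe.1 (Finset.mem_erase.1 (hB hi)).2
          simp only [ind, hi, if_true]
          omega
        · have : ¬ l.1 i + 2 ≤ nu.1 i := fun h => hi (hA.2 (mem_rowsGe.2 h))
          simp only [ind, hi, if_false]
          omega
    · ext i
      rw [mem_rowsGe]
      by_cases hi : i ∈ S <;> simp [ind, hi]

theorem exists_chain_of_chainCount_ne_zero {n : ℕ} {p : Part n → Prop} {l nu : Part n} {a b : ℤ}
    (h : chainCount p l nu a b ≠ 0) : ∃ m, m ∈ strips l a ∧ p m ∧ nu ∈ strips m b := by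
  classical
  obtain ⟨m, hm⟩ := Finset.card_ne_zero.1 h
  exact ⟨m, mem_chains.1 hm⟩

theorem chainCount_succ_le {n k : ℕ} [NeZero n] {l nu : Part n} (hl : l.width ≤ k)
    (hnu : nu.width ≤ k) {a b : ℕ} (hab : b ≤ a) :
    chainCount (fun m => ¬ m.width ≤ k) l nu (a + 1) (b - 1) ≤
      chainCount (fun m => ¬ m.width ≤ k) l nu a b := by
  by_cases h0 : chainCount (fun m => ¬ m.width ≤ k) l nu (a + 1) (b - 1) = 0
  · omega
  obtain ⟨m, h1, hm, h2⟩ := exists_chain_of_chainCount_ne_zero h0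
  rw [mem_strips] at h1 h2
  have h := Leaves.of_chain hl hnu h1.1 h2.1 hm
  have hs : (nu.size : ℤ) = l.size + (a + b) := by omega
  have e := h.chainCount_eq (x := a + 1) (y := b - 1) (by push_cast; omega)
  push_cast at e
  rw [e, h.chainCount_eq hs]
  apply lowerCount_succ_le
  · intro i j hij hf hj
    rw [Finset.mem_insert] at hj ⊢
    rcases hj with rfl | hj
    · exact Or.inl (le_antisymm hij (Fin.zero_le _))
    · exact Or.inr (fiberLower_rowsGe l nu 2 i j hij hf hj)
  · intro i j hij hf hj
    rw [Finset.mem_erase] at hj ⊢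
    refine ⟨?_, fiberLower_rowsGe l nu 1 i j hij hf hj.2⟩
    rintro rfl
    exact hj.1 (le_antisymm (le_rev_zero _) hij)
  -- Inserting the first row adds at most one and erasing the last row removes one, so the two sizes
  -- sum to at most `|ν| - |λ| = a + b ≤ 2a`.
  · have e1 := size_eq_add_card_rowsGe h.between
    have hL : Fin.rev 0 ∈ rowsGe l nu 1 := mem_rowsGe.2 h.last.ge
    have e2 := Finset.card_erase_add_one hL
    have e3 := Finset.card_insert_le 0 (rowsGe l nu 2)
    omega

/-! ### Paths that fill two vertical strips from top to bottom -/

/-- The number of elements of `S` that precede `i`. -/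
def setRank {n : ℕ} (S : Finset (Fin n)) (i : Fin n) : ℕ := (S.filter fun j => j < i).card

theorem setRank_lt {n : ℕ} {S : Finset (Fin n)} {i j : Fin n} (hi : i ∈ S) (h : i < j) :
    setRank S i < setRank S j := by
  refine Finset.card_lt_card (Finset.ssubset_iff_of_subset ?_ |>.2 ⟨i, ?_, by simp⟩)
  · intro x hx
    rw [Finset.mem_filter] at hx ⊢
    exact ⟨hx.1, hx.2.trans h⟩
  · simp [hi, h]

theorem setRank_inj {n : ℕ} {S : Finset (Fin n)} {i j : Fin n} (hi : i ∈ S) (hj : j ∈ S)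
    (h : setRank S i = setRank S j) : i = j := by
  rcases lt_trichotomy i j with h' | h' | h'
  · exact absurd h (setRank_lt hi h').ne
  · exact h'
  · exact absurd h (setRank_lt hj h').ne'

theorem lt_of_setRank_lt {n : ℕ} {S : Finset (Fin n)} {i j : Fin n} (hj : j ∈ S)
    (h : setRank S i < setRank S j) : i < j := by
  rcases lt_trichotomy i j with h' | rfl | h'
  · exact h'
  · exact absurd h (lt_irrefl _)
  · exact absurd h (not_lt.2 (setRank_lt hj h').le)

theorem setRank_lt_card {n : ℕ} {S : Finset (Fin n)} {i : Fin n} (hi : i ∈ S) :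
    setRank S i < S.card :=
  Finset.card_lt_card (Finset.ssubset_iff_of_subset (Finset.filter_subset _ _) |>.2
    ⟨i, hi, by simp⟩)

theorem setRank_zero {n : ℕ} [NeZero n] (S : Finset (Fin n)) : setRank S 0 = 0 := by
  simp [setRank]

theorem exists_setRank_eq {n : ℕ} {S : Finset (Fin n)} {t : ℕ} (ht : t < S.card) :
    ∃ i ∈ S, setRank S i = t := by
  have himg : S.image (setRank S) = Finset.range S.card := by
    refine Finset.eq_of_subset_of_card_le ?_ ?_
    · intro x hx
      obtain ⟨i, hi, rfl⟩ := Finset.mem_image.1 hx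
      exact Finset.mem_range.2 (setRank_lt_card hi)
    · rw [Finset.card_image_of_injOn fun i hi j hj => setRank_inj hi hj, Finset.card_range]
  exact Finset.mem_image.1 (himg ▸ Finset.mem_range.2 ht)

/-- The `t`-th term of the path that adds first the boxes in the rows of `S` and then those in the
rows of `T`, each from top to bottom. -/
def fillRow {n : ℕ} (l : Fin n → ℕ) (S T : Finset (Fin n)) (t : ℕ) : Fin n → ℕ := fun i =>
  l i + (if i ∈ S ∧ setRank S i < t then 1 else 0) +
    (if i ∈ T ∧ S.card + setRank T i < t then 1 else 0)

theorem fillRow_of_le {n : ℕ} (l : Fin n → ℕ) (S T : Finset (Fin n)) {t : ℕ} (ht : t ≤ S.card)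
    (i : Fin n) : fillRow l S T t i = l i + if i ∈ S ∧ setRank S i < t then 1 else 0 := by
  rw [fillRow, if_neg (c := i ∈ T ∧ S.card + setRank T i < t) (by omega), add_zero]

theorem fillRow_of_ge {n : ℕ} (l : Fin n → ℕ) (S T : Finset (Fin n)) {t : ℕ} (ht : S.card ≤ t)
    (i : Fin n) : fillRow l S T t i =
      (l + ind S) i + if i ∈ T ∧ S.card + setRank T i < t then 1 else 0 := by
  have : (i ∈ S ∧ setRank S i < t) ↔ i ∈ S :=
    ⟨fun h => h.1, fun h => ⟨h, (setRank_lt_card h).trans_le ht⟩⟩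
  simp only [fillRow, this, Pi.add_apply, ind]

theorem fillRow_antitone {n : ℕ} {l : Fin n → ℕ} (hl : Antitone l) {S T : Finset (Fin n)}
    (hS : FiberLower l S) (hκ : Antitone (l + ind S)) (hT : FiberLower (l + ind S) T) (t : ℕ) :
    Antitone (fillRow l S T t) := by
  -- This treats a single strip `U` over `m`: within a block of equal rows, a filled row has all
  -- rows above it in `U` and filled no later.
  have key : ∀ (m : Fin n → ℕ) (U : Finset (Fin n)) (r : ℕ), Antitone m → FiberLower m U →
      ∀ i j, i ≤ j → m j + (if j ∈ U ∧ r + setRank U j < t then 1 else 0) ≤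
        m i + (if i ∈ U ∧ r + setRank U i < t then 1 else 0) := by
    intro m U r hm hU i j hij
    have h1 := hm hij
    rcases h1.lt_or_eq with h | h
    · split_ifs <;> omega
    · by_cases hj : j ∈ U ∧ r + setRank U j < t
      · have hi := hU i j hij h.symm hj.1
        have : setRank U i ≤ setRank U j := by
          rcases hij.lt_or_eq with h' | rfl
          · exact (setRank_lt hi h').le
          · exact le_rfl
        rw [if_pos hj, if_pos ⟨hi, by omega⟩, h]
      · rw [if_neg hj]
        omega
  intro i j hij
  rcases le_total t S.card with ht | ht
  · rw [fillRow_of_le _ _ _ ht, fillRow_of_le _ _ _ ht]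
    simpa using key l S 0 hl hS i j hij
  · rw [fillRow_of_ge _ _ _ ht, fillRow_of_ge _ _ _ ht]
    exact key _ T S.card hκ hT i j hij

theorem fillRow_zero {n : ℕ} (l : Fin n → ℕ) (S T : Finset (Fin n)) : fillRow l S T 0 = l := by
  funext i
  simp [fillRow]

theorem fillRow_card {n : ℕ} (l : Fin n → ℕ) (S T : Finset (Fin n)) :
    fillRow l S T S.card = l + ind S := by
  funext i
  rw [fillRow_of_ge _ _ _ le_rfl, if_neg (by omega), add_zero]

theorem fillRow_card_add_card {n : ℕ} (l : Fin n → ℕ) (S T : Finset (Fin n)) :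
    fillRow l S T (S.card + T.card) = l + ind S + ind T := by
  funext i
  have : (i ∈ T ∧ S.card + setRank T i < S.card + T.card) ↔ i ∈ T :=
    ⟨fun h => h.1, fun h => ⟨h, by have := setRank_lt_card h; omega⟩⟩
  rw [fillRow_of_ge _ _ _ (Nat.le_add_right _ _)]
  simp only [this, Pi.add_apply, ind]

theorem fillRow_succ_left {n : ℕ} (l : Fin n → ℕ) {S : Finset (Fin n)} (T : Finset (Fin n))
    {t : ℕ} {i : Fin n} (hi : i ∈ S) (ht : setRank S i = t) :
    fillRow l S T (t + 1) = fillRow l S T t + Pi.single i 1 := by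
  have hlt := setRank_lt_card hi
  funext j
  rw [Pi.add_apply, fillRow_of_le _ _ _ (by omega), fillRow_of_le _ _ _ (by omega)]
  by_cases hj : j = i
  · subst hj
    simp [hi, ht]
  · rw [Pi.single_eq_of_ne hj, add_zero]
    have : j ∈ S → setRank S j ≠ t := fun hjS h => hj (setRank_inj hjS hi (h.trans ht.symm))
    congr 1
    refine if_congr (and_congr_right fun hjS => ?_) rfl rfl
    have := this hjS
    omega

theorem fillRow_succ_right {n : ℕ} (l : Fin n → ℕ) (S : Finset (Fin n)) {T : Finset (Fin n)}
    {t : ℕ} {i : Fin n} (hi : i ∈ T) (ht : S.card + setRank T i = t) :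
    fillRow l S T (t + 1) = fillRow l S T t + Pi.single i 1 := by
  funext j
  rw [Pi.add_apply, fillRow_of_ge _ _ _ (by omega), fillRow_of_ge _ _ _ (by omega)]
  by_cases hj : j = i
  · subst hj
    simp [hi, ht]
  · rw [Pi.single_eq_of_ne hj, add_zero]
    have : j ∈ T → setRank T j ≠ setRank T i := fun hjT h => hj (setRank_inj hjT hi h)
    congr 1
    refine if_congr (and_congr_right fun hjT => ?_) rfl rfl
    have := this hjT
    omega

theorem YoungPath.label_eq {n : ℕ} {l nu : Part n} (P : YoungPath l nu) (t : Fin P.length)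
    {i : Fin n} (h : (P.vertex t.succ).1 = (P.vertex t.castSucc).1 + Pi.single i 1) :
    P.label t = ((P.vertex t.castSucc).1 i : ℤ) - i := by
  have hf : (Finset.univ.filter fun j => (P.vertex t.castSucc).1 j < (P.vertex t.succ).1 j)
      = {i} := by
    ext j
    rw [h]
    by_cases hj : j = i
    · subst hj
      simp
    · simp [hj]
  rw [YoungPath.label, hf, Finset.sum_singleton, h]
  simp only [Pi.add_apply, Pi.single_eq_same]
  push_cast
  ring

section FillPath

variable {n : ℕ} {l nu : Part n} {S T : Finset (Fin n)}

/-- The path from `λ` to `ν = λ + 1_S + 1_T` that adds first the boxes in the rows of `S` and then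
those in the rows of `T`, each from top to bottom. -/
def fillPath (hS : FiberLower l.1 S) (hT : FiberLower (l.1 + ind S) T)
    (hnu : nu.1 = l.1 + ind S + ind T) : YoungPath l nu where
  length := S.card + T.card
  vertex t := ⟨fillRow l.1 S T t, fillRow_antitone l.2 hS (antitone_add_ind l hS) hT t⟩
  start_eq := Subtype.ext (fillRow_zero _ _ _)
  end_eq := Subtype.ext ((fillRow_card_add_card _ _ _).trans hnu.symm)
  step t := by
    rcases lt_or_ge (t : ℕ) S.card with h | h
    · obtain ⟨i, hi, ht⟩ := exists_setRank_eq h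
      exact ⟨i, fillRow_succ_left _ _ hi ht⟩
    · have h2 := t.2
      obtain ⟨i, hi, ht⟩ := exists_setRank_eq (S := T) (t := t - S.card) (by omega)
      exact ⟨i, fillRow_succ_right _ _ hi (t := t) (by omega)⟩

theorem fillPath_label_left (hS : FiberLower l.1 S) (hT : FiberLower (l.1 + ind S) T)
    (hnu : nu.1 = l.1 + ind S + ind T) (t : Fin (fillPath hS hT hnu).length) (ht : (t : ℕ) < S.card) :
    ∃ i ∈ S, setRank S i = t ∧ (fillPath hS hT hnu).label t = (l.1 i : ℤ) - i := by
  obtain ⟨i, hi, h⟩ := exists_setRank_eq ht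
  refine ⟨i, hi, h, ?_⟩
  rw [YoungPath.label_eq _ t (i := i) (fillRow_succ_left _ _ hi h)]
  have : fillRow l.1 S T t i = l.1 i := by
    rw [fillRow_of_le _ _ _ ht.le, if_neg (by omega), add_zero]
  exact congrArg (fun x : ℕ => (x : ℤ) - i) this

theorem fillPath_label_right (hS : FiberLower l.1 S) (hT : FiberLower (l.1 + ind S) T)
    (hnu : nu.1 = l.1 + ind S + ind T) (t : Fin (fillPath hS hT hnu).length)
    (ht : S.card ≤ (t : ℕ)) : ∃ i ∈ T, S.card + setRank T i = t ∧
      (fillPath hS hT hnu).label t = ((l.1 + ind S) i : ℕ) - (i : ℤ) := by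
  have h2 : (t : ℕ) < S.card + T.card := t.2
  obtain ⟨i, hi, h⟩ := exists_setRank_eq (S := T) (t := t - S.card) (by omega)
  have h3 : S.card + setRank T i = t := by omega
  refine ⟨i, hi, h3, ?_⟩
  rw [YoungPath.label_eq _ t (i := i) (fillRow_succ_right _ _ hi h3)]
  have : fillRow l.1 S T t i = (l.1 + ind S) i := by
    rw [fillRow_of_ge _ _ _ ht, if_neg (by omega), add_zero]
  exact congrArg (fun x : ℕ => (x : ℤ) - i) this

theorem Iio_fin_two_zero : Finset.Iio (0 : Fin 2) = ∅ := rfl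

theorem Iio_fin_two_one : Finset.Iio (1 : Fin 2) = {0} := rfl

theorem Iic_fin_two_zero : Finset.Iic (0 : Fin 2) = {0} := rfl

theorem Iic_fin_two_one : Finset.Iic (1 : Fin 2) = {0, 1} := rfl

/-- Going down the rows of one strip, the content `l i - i` strictly decreases, so filling from top
to bottom gives decreasing labels. -/
theorem fillPath_hasAscentsIn (hS : FiberLower l.1 S) (hT : FiberLower (l.1 + ind S) T)
    (hnu : nu.1 = l.1 + ind S + ind T) {α : Fin 2 → ℤ} (h0 : α 0 = S.card) (h1 : α 1 = T.card) :
    (fillPath hS hT hnu).HasAscentsIn α := by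
  refine ⟨fun i => ?_, ?_, ?_⟩
  · fin_cases i
    · exact h0 ▸ Int.natCast_nonneg _
    · exact h1 ▸ Int.natCast_nonneg _
  · rw [Fin.sum_univ_two, h0, h1]
    exact (Nat.cast_add _ _).symm
  · intro i s t hst hs ht
    have hst' : (s : ℕ) < t := hst
    fin_cases i
    · simp only [Fin.zero_eta, Iio_fin_two_zero, Iic_fin_two_zero, Finset.sum_empty,
        Finset.sum_singleton, h0] at hs ht
      obtain ⟨i, hi, hi1, e1⟩ := fillPath_label_left hS hT hnu s (by omega)
      obtain ⟨j, hj, hj1, e2⟩ := fillPath_label_left hS hT hnu t (by omega)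
      have hij : i < j := lt_of_setRank_lt hj (by omega)
      have := l.2 hij.le
      rw [e1, e2]
      have : (i : ℕ) < j := hij
      omega
    · simp only [Fin.mk_one, Iio_fin_two_one, Iic_fin_two_one, Finset.sum_singleton, h0] at hs ht
      obtain ⟨i, hi, hi1, e1⟩ := fillPath_label_right hS hT hnu s (by omega)
      obtain ⟨j, hj, hj1, e2⟩ := fillPath_label_right hS hT hnu t (by omega)
      have hij : i < j := lt_of_setRank_lt hj (by omega)
      have := antitone_add_ind l hS hij.le
      rw [e1, e2]
      have : (i : ℕ) < j := hij
      omega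

theorem fillPath_mem_Omega [NeZero n] {k : ℕ} {mu : Part n} (hS : FiberLower l.1 S)
    (hT : FiberLower (l.1 + ind S) T) (hnu : nu.1 = l.1 + ind S + ind T) {σ : Equiv.Perm (Fin 2)}
    (h0 : dotAction σ (fun j => (mu.conj j : ℤ)) 0 = S.card)
    (h1 : dotAction σ (fun j => (mu.conj j : ℤ)) 1 = T.card)
    (hmid : (l.1 + ind S) 0 - (l.1 + ind S) (Fin.rev 0) ≤ k) (hw : nu.width ≤ k) :
    (σ, fillPath hS hT hnu) ∈ Omega 2 k l mu nu := by
  refine ⟨fillPath_hasAscentsIn hS hT hnu h0 h1, fun i t ht => ?_⟩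
  change fillRow l.1 S T t 0 - fillRow l.1 S T t (Fin.rev 0) ≤ k
  fin_cases i
  · simp only [Fin.zero_eta, Iic_fin_two_zero, Finset.sum_singleton, h0] at ht
    have ht' : (t : ℕ) = S.card := by exact_mod_cast ht
    rw [ht', fillRow_card]
    exact hmid
  · rw [Fin.mk_one, Iic_fin_two_one, Finset.sum_pair zero_ne_one, h0, h1] at ht
    have ht' : (t : ℕ) = S.card + T.card := by exact_mod_cast ht
    rw [ht', fillRow_card_add_card, ← hnu]
    exact hw

end FillPath

theorem dotAction_one {m : ℕ} (α : Fin m → ℤ) : dotAction 1 α = α := by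
  funext i
  simp [dotAction]

/-- For the transposition the blocks have lengths `μ'₂ - 1` and `μ'₁ + 1`, the shorter one coming
first. -/
theorem dotAction_swap_zero (α : Fin 2 → ℤ) : dotAction (Equiv.swap 0 1) α 0 = α 1 - 1 := by
  simp [dotAction]

theorem dotAction_swap_one (α : Fin 2 → ℤ) : dotAction (Equiv.swap 0 1) α 1 = α 0 + 1 := by
  simp [dotAction]

/-! ### Paths through an unrestricted partition -/

theorem fiberLower_rest {n : ℕ} (l nu : Part n) (S : Finset (Fin n)) :
    FiberLower (l.1 + ind S) (Finset.univ.filter fun i => (l.1 + ind S) i < nu.1 i) := by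
  intro i j hij hf hj
  rw [Finset.mem_filter] at hj ⊢
  exact ⟨Finset.mem_univ _, hf ▸ hj.2.trans_le (nu.2 hij)⟩

section Leaves

variable {n k : ℕ} [NeZero n] {l nu : Part n}

theorem Leaves.eq_add_ind (h : Leaves k l nu) {S : Finset (Fin n)} (hA : rowsGe l nu 2 ⊆ S)
    (hB : S ⊆ rowsGe l nu 1) :
    nu.1 = l.1 + ind S + ind (Finset.univ.filter fun i => (l.1 + ind S) i < nu.1 i) := by
  funext i
  have hb := h.between i
  have h2 : ¬ i ∈ S → ¬ l.1 i + 2 ≤ nu.1 i := fun hi h' => hi (hA (mem_rowsGe.2 h'))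
  have h1 : i ∈ S → l.1 i + 1 ≤ nu.1 i := fun hi => mem_rowsGe.1 (hB hi)
  have hT : ind (Finset.univ.filter fun i => (l.1 + ind S) i < nu.1 i) i =
      if (l.1 + ind S) i < nu.1 i then 1 else 0 := if_congr (by simp) rfl rfl
  rw [Pi.add_apply, hT]
  by_cases hi : i ∈ S
  · have := h1 hi
    have e : (l.1 + ind S) i = l.1 i + 1 := by simp [ind, hi]
    rw [e]
    split_ifs <;> omega
  · have := h2 hi
    have e : (l.1 + ind S) i = l.1 i := by simp [ind, hi]
    rw [e]
    split_ifs <;> omega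

/-- If a set of rows between `λ` and `ν` contains both or neither of the first and the last row,
then filling it first gives a path in `Ω_k` through a partition that is not restricted. -/
theorem Leaves.exists_mem_Omega (h : Leaves k l nu) (hne : (0 : Fin n) ≠ Fin.rev 0)
    (hnu : nu.width ≤ k) {mu : Part n} {σ : Equiv.Perm (Fin 2)} {S : Finset (Fin n)}
    (hS : FiberLower l.1 S) (hA : rowsGe l nu 2 ⊆ S) (hB : S ⊆ rowsGe l nu 1)
    (hiff : 0 ∈ S ↔ Fin.rev 0 ∈ S)
    (h0 : dotAction σ (fun j => (mu.conj j : ℤ)) 0 = S.card)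
    (hs : dotAction σ (fun j => (mu.conj j : ℤ)) 0 + dotAction σ (fun j => (mu.conj j : ℤ)) 1
      = (nu.size : ℤ) - l.size) :
    ∃ p ∈ Omega 2 k l mu nu, ∃ t, ¬ (p.2.vertex t).width ≤ k := by
  set T := Finset.univ.filter fun i => (l.1 + ind S) i < nu.1 i with hTdef
  have hT : FiberLower (l.1 + ind S) T := fiberLower_rest l nu S
  have hν : nu.1 = l.1 + ind S + ind T := h.eq_add_ind hA hB
  have hlt : (0 : Fin n) < Fin.rev 0 := lt_of_le_of_ne (Fin.zero_le _) hne
  have hcard : nu.size = l.size + (S.card + T.card) := by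
    simp only [Part.size, hν, Pi.add_apply, Finset.sum_add_distrib, sum_ind, add_assoc]
  have hw := h.width
  have hind : ind S 0 = ind S (Fin.rev 0) := by simp only [ind, hiff]
  refine ⟨(σ, fillPath hS hT hν), fillPath_mem_Omega hS hT hν h0 (by omega) ?_ hnu, ?_⟩
  · rw [Pi.add_apply, Pi.add_apply, hind]
    omega
  have hmem : ∀ {i}, i ∈ T ↔ (l.1 + ind S) i < nu.1 i := by simp [hTdef]
  -- The block that contains both extreme rows fills row `0` in its first step and the last row
  -- later, so right after that first step the width is `k + 1`.
  by_cases hS0 : 0 ∈ S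
  · have hSL := hiff.1 hS0
    have hr := setRank_lt hS0 hlt
    have hc := setRank_lt_card hSL
    refine ⟨⟨1, by change 1 < S.card + T.card + 1; omega⟩, ?_⟩
    change ¬ fillRow l.1 S T 1 0 - fillRow l.1 S T 1 (Fin.rev 0) ≤ k
    rw [fillRow_of_le _ _ _ (by omega), fillRow_of_le _ _ _ (by omega),
      if_pos ⟨hS0, by rw [setRank_zero]; omega⟩, if_neg (by omega)]
    omega
  · have hSL : Fin.rev 0 ∉ S := fun h => hS0 (hiff.2 h)
    have e0 : (l.1 + ind S) 0 = l.1 0 := by simp [ind, hS0]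
    have eL : (l.1 + ind S) (Fin.rev 0) = l.1 (Fin.rev 0) := by simp [ind, hSL]
    have hT0 : 0 ∈ T := hmem.2 (by rw [e0, h.first]; omega)
    have hTL : Fin.rev 0 ∈ T := hmem.2 (by rw [eL, h.last]; omega)
    have hr := setRank_lt hT0 hlt
    have hc := setRank_lt_card hTL
    refine ⟨⟨S.card + 1, by change S.card + 1 < S.card + T.card + 1; omega⟩, ?_⟩
    change ¬ fillRow l.1 S T (S.card + 1) 0 - fillRow l.1 S T (S.card + 1) (Fin.rev 0) ≤ k
    rw [fillRow_of_ge _ _ _ (by omega), fillRow_of_ge _ _ _ (by omega), e0, eL,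
      if_pos ⟨hT0, by rw [setRank_zero]; omega⟩, if_neg (by omega)]
    omega

/-- A new first strip `S` is chosen that treats the first and the last row alike. With `σ = 1` it
contains both, if `μ'₁` boxes suffice for that. Otherwise there are enough other rows for a set of
`μ'₂ - 1` rows that avoids both, with σ the transposition. -/
theorem exists_mem_Omega_of_chain {mu m : Part n} (hl : l.width ≤ k) (hmuw : mu.width ≤ k)
    (hnu : nu.width ≤ k) (h1 : m ∈ strips l (mu.conj 0))
    (h2 : nu ∈ strips m (mu.conj 1)) (hm : ¬ m.width ≤ k) :
    ∃ p ∈ Omega 2 k l mu nu, ∃ t, ¬ (p.2.vertex t).width ≤ k := by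
  rw [mem_strips] at h1 h2
  have h := Leaves.of_chain hl hnu h1.1 h2.1 hm
  have hab := mu.conj_antitone zero_le_one
  have hsize := size_eq_add_card_rowsGe h.between
  have hm0 := h1.1 0
  have hmL := h1.1 (Fin.rev 0)
  have hfirst := h.first
  have hlast := h.last
  have hwidth := h.width
  have hn0 := h2.1 0
  have hnL := h2.1 (Fin.rev 0)
  simp only [Part.width] at hm
  have hne : (0 : Fin n) ≠ Fin.rev 0 := fun he => by
    rw [← he] at hm
    omega
  have hm' := size_eq_add_card_rowsGe (l := l) (nu := m) fun i => by
    have := h1.1 i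
    omega
  have he : rowsGe l m 2 = ∅ := by
    rw [rowsGe, Finset.filter_eq_empty_iff]
    intro i _
    have := h1.1 i
    omega
  rw [he, Finset.card_empty] at hm'
  have hsub1 : insert 0 (rowsGe l nu 2) ⊆ rowsGe l m 1 := by
    rw [Finset.insert_subset_iff, mem_rowsGe]
    refine ⟨by omega, fun i hi => ?_⟩
    rw [mem_rowsGe] at hi ⊢
    have := h2.1 i
    omega
  have hsub2 : insert (Fin.rev 0) (rowsGe l m 1) ⊆ rowsGe l nu 1 := by
    rw [Finset.insert_subset_iff, mem_rowsGe]
    refine ⟨by omega, fun i hi => ?_⟩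
    rw [mem_rowsGe] at hi ⊢
    have := h2.1 i
    omega
  have hc1 := Finset.card_le_card hsub1
  have hc2 := Finset.card_le_card hsub2
  rw [Finset.card_insert_of_notMem (by rw [mem_rowsGe]; omega)] at hc1
  rw [Finset.card_insert_of_notMem (by rw [mem_rowsGe]; omega)] at hc2
  -- For `k = 0` all parts of μ are equal, so its first column has length `0` or `n`; but the first
  -- strip contains the first row and misses the last. With `k ≥ 1` the blocks of the first and the
  -- last row of λ are disjoint.
  have hk : 1 ≤ k := by
    by_contra hk
    have hmu : ∀ i, mu.1 i = mu.1 0 := fun i => by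
      have := mu.2 (Fin.zero_le i)
      have := mu.2 (le_rev_zero i)
      simp only [Part.width] at hmuw
      omega
    have hle : (rowsGe l nu 1).card ≤ n := (Finset.card_le_univ _).trans (by simp)
    have hconj : mu.conj 0 = 0 ∨ mu.conj 0 = n := by
      rcases Nat.eq_zero_or_pos (mu.1 0) with h' | h'
      · left
        rw [Part.conj, Finset.card_eq_zero, Finset.filter_eq_empty_iff]
        intro i _
        rw [hmu i]
        omega
      · right
        rw [Part.conj, Finset.filter_true_of_mem fun i _ => by rw [hmu i]; exact h']
        simp
    omega
  classical
  set blockL := Finset.univ.filter fun i => l.1 i = l.1 (Fin.rev 0) with hblockL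
  set block0 := Finset.univ.filter fun i => l.1 i = l.1 0 with hblock0
  have memL : ∀ {i}, i ∈ blockL ↔ l.1 i = l.1 (Fin.rev 0) := by simp [hblockL]
  have mem0 : ∀ {i}, i ∈ block0 ↔ l.1 i = l.1 0 := by simp [hblock0]
  have hLavail : blockL ⊆ rowsGe l nu 1 := fun i hi => by
    rw [memL] at hi
    rw [mem_rowsGe]
    have := nu.2 (le_rev_zero i)
    omega
  have hA1sub : insert 0 (rowsGe l nu 2 ∪ blockL) ⊆ rowsGe l nu 1 := by
    refine Finset.insert_subset (mem_rowsGe.2 (by omega)) (Finset.union_subset ?_ hLavail)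
    intro i hi
    rw [mem_rowsGe] at hi ⊢
    omega
  have hB2sub : rowsGe l nu 2 ⊆ (rowsGe l nu 1 \ block0).erase (Fin.rev 0) := by
    intro i hi
    rw [mem_rowsGe] at hi
    rw [Finset.mem_erase, Finset.mem_sdiff, mem_rowsGe, mem0]
    refine ⟨?_, by omega, fun h' => ?_⟩
    · rintro rfl
      omega
    · have := nu.2 (Fin.zero_le i)
      omega
  -- To contain the last row, an initial set must contain its whole block `blockL`; to avoid row `0`
  -- it must avoid all of `block0`.
  by_cases hcase : (insert 0 (rowsGe l nu 2 ∪ blockL)).card ≤ mu.conj 0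
  · obtain ⟨S, hAS, hSB, hS, hSc⟩ := exists_fiberLower (f := l.1) (a := mu.conj 0) (by
      intro i j hij hf hj
      rw [Finset.mem_insert, Finset.mem_union] at hj ⊢
      rcases hj with rfl | hj | hj
      · exact Or.inl (le_antisymm hij (Fin.zero_le _))
      · exact Or.inr (Or.inl (fiberLower_rowsGe l nu 2 i j hij hf hj))
      · exact Or.inr (Or.inr (memL.2 (hf.trans (memL.1 hj))))) (fiberLower_rowsGe l nu 1) hA1sub
      hcase (by omega)
    rw [Finset.insert_subset_iff, Finset.union_subset_iff] at hAS
    refine h.exists_mem_Omega hne hnu (σ := 1) hS hAS.2.1 hSB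
      (iff_of_true hAS.1 (hAS.2.2 (memL.2 rfl))) ?_ ?_
    · rw [dotAction_one, hSc]
      rfl
    · rw [dotAction_one]
      change (mu.conj 0 : ℤ) + mu.conj 1 = _
      omega
  -- The forced set has at least `μ'₁ + 1` rows. Those other than row `0` lie outside `block0`, and
  -- discarding the last row still leaves at least `μ'₁ - 1 ≥ μ'₂ - 1` candidates. The subtraction
  -- is not truncated: `hc2` and the box count give `μ'₂ ≥ |rowsGe l nu 2| + 1`.
  · have hbound : mu.conj 1 - 1 ≤ ((rowsGe l nu 1 \ block0).erase (Fin.rev 0)).card := by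
      have e1 := Finset.card_insert_le 0 (rowsGe l nu 2 ∪ blockL)
      have e2 := Finset.pred_card_le_card_erase (s := rowsGe l nu 1 \ block0) (a := Fin.rev 0)
      have e3 : (rowsGe l nu 2 ∪ blockL).card ≤ (rowsGe l nu 1 \ block0).card := by
        refine Finset.card_le_card (Finset.union_subset ?_ fun i hi => ?_)
        · exact hB2sub.trans (Finset.erase_subset _ _)
        · rw [Finset.mem_sdiff, mem0]
          refine ⟨hLavail hi, ?_⟩
          rw [memL] at hi
          omega
      omega
    obtain ⟨S, hAS, hSB, hS, hSc⟩ := exists_fiberLower (f := l.1) (a := mu.conj 1 - 1)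
      (fiberLower_rowsGe l nu 2) (by
        intro i j hij hf hj
        rw [Finset.mem_erase, Finset.mem_sdiff, mem0] at hj ⊢
        refine ⟨?_, fiberLower_rowsGe l nu 1 i j hij hf hj.2.1, fun h' => hj.2.2 (hf ▸ h')⟩
        rintro rfl
        exact hj.1 (le_antisymm (le_rev_zero _) hij)) hB2sub (by omega) hbound
    have hS0 : 0 ∉ S := fun h' =>
      (Finset.mem_sdiff.1 (Finset.mem_erase.1 (hSB h')).2).2 (mem0.2 rfl)
    have hSL : Fin.rev 0 ∉ S := fun h' => (Finset.mem_erase.1 (hSB h')).1 rfl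
    refine h.exists_mem_Omega hne hnu (σ := Equiv.swap 0 1) hS hAS
      (hSB.trans ((Finset.erase_subset _ _).trans Finset.sdiff_subset)) (iff_of_false hS0 hSL) ?_ ?_
    · rw [dotAction_swap_zero, hSc]
      change (mu.conj 1 : ℤ) - 1 = _
      omega
    · rw [dotAction_swap_zero, dotAction_swap_one]
      change (mu.conj 1 : ℤ) - 1 + (mu.conj 0 + 1) = _
      omega

end Leaves

/-! ### Equality of the coefficients and the main theorem -/

theorem fusionCoeff_eq_lrCoeff {n k : ℕ} [NeZero n] (lam mu nu : RestrictedPart n k)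
    (hmu : ∀ i, mu.1.1 i ≤ 2)
    (h : ∀ m ∈ strips lam.1 (mu.1.conj 0), nu.1 ∈ strips m (mu.1.conj 1) → m.width ≤ k) :
    fusionCoeff lam mu nu = lrCoeff lam.1 mu.1 nu.1 := by
  have h1 := lrCoeff_sub_fusionCoeff lam mu nu hmu
  -- By this inequality the absence of unrestricted chains with lengths `μ'₁, μ'₂` also rules out
  -- those with lengths `μ'₁ + 1, μ'₂ - 1`.
  have h2 := chainCount_succ_le lam.2 nu.2 (mu.1.conj_antitone zero_le_one)
  have h3 : chainCount (fun m => ¬ m.width ≤ k) lam.1 nu.1 (mu.1.conj 0) (mu.1.conj 1) = 0 := by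
    by_contra h0
    obtain ⟨m, hm, hw, hn⟩ := exists_chain_of_chainCount_ne_zero h0
    exact hw (h m hm hn)
  rw [h3, Nat.le_zero] at h2
  rw [h2, h3, sub_self] at h1
  exact (sub_eq_zero.1 h1).symm

end Fusion

end

theorem corollary14 (n k : ℕ) [NeZero n] :
    -- the coefficients are well defined
    Fusion.IsLinearBasis (Fusion.schur (n := n)) ∧
    Fusion.IsLinearBasis (Fusion.fusionSchur n k) ∧
    ∀ lam mu nu : Fusion.RestrictedPart n k, mu.1.1 0 ≤ 2 →
      -- (a)
      Fusion.fusionCoeff lam mu nu ≤ Fusion.lrCoeff lam.1 mu.1 nu.1 ∧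
      -- (b)
      ((∀ p ∈ Fusion.Omega 2 k lam.1 mu.1 nu.1, ∀ t, (p.2.vertex t).width ≤ k) →
        Fusion.fusionCoeff lam mu nu = Fusion.lrCoeff lam.1 mu.1 nu.1) ∧
      (lam.1.width + 1 ≤ k →
        Fusion.fusionCoeff lam mu nu = Fusion.lrCoeff lam.1 mu.1 nu.1) := by
  refine ⟨Fusion.isLinearBasis_schur n, Fusion.isLinearBasis_fusionSchur n k, ?_⟩
  intro lam mu nu hmu0
  have hmu : ∀ i, mu.1.1 i ≤ 2 := fun i => (mu.1.2 (Fin.zero_le i)).trans hmu0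
  refine ⟨?_, fun h => ?_, fun h => ?_⟩
  · have h1 := Fusion.lrCoeff_sub_fusionCoeff lam mu nu hmu
    have h2 := Fusion.chainCount_succ_le lam.2 nu.2 (mu.1.conj_antitone zero_le_one)
    rw [← sub_nonneg, h1, sub_nonneg]
    exact_mod_cast h2
  · refine Fusion.fusionCoeff_eq_lrCoeff lam mu nu hmu fun m hm hn => ?_
    by_contra hw
    obtain ⟨p, hp, t, ht⟩ := Fusion.exists_mem_Omega_of_chain lam.2 mu.2 nu.2 hm hn hw
    exact ht (h p hp t)
  · refine Fusion.fusionCoeff_eq_lrCoeff lam mu nu hmu fun m hm _ => ?_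
    exact (Fusion.mem_strips.1 hm).1.width_le.trans h
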